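/- Let $n\ge 1$ and $\theta>1/2$. For $f\in L^2(\mathbf R^n)$ let $\hat f(\xi)=\int_{\mathbf R^n}e^{-ix\cdot\xi}f(x)\,dx$ denote the Fourier transform (extended to $L^2$), and let $L_\theta f=\mathcal F^{-1}\bigl(\log(1+|\xi|^{2\theta})\hat f(\xi)\bigr)$ with domain $D(L_\theta)=\{f\in L^2(\mathbf R^n): \log(1+|\xi|^{2\theta})\hat f\in L^2(\mathbf R^n)\}$. Consider the Cauchy problem $$u_{tt}-\Delta u+L_\theta u_t=0\quad (t>0,\ x\in\mathbf R^n),\qquad u(0,x)=0,\quad u_t(0,x)=u_1(x).$$ A mild solution is a function $u\in C([0,\infty);H^1(\mathbf R^n))\cap C^1([0,\infty);L^2(\mathbf R^n))$ with $u(0)=0$, $u_t(0)=u_1$ such that, for every $t\ge0$, $u(t)\in D(L_\theta)$, $\int_0^t u(s)\,ds\in H^2(\mathbf R^n)$ and $u_t(t)=u_1+\Delta\int_0^t u(s)\,ds-L_\theta u(t)$. There are constants $C>0$ and $T_0>1$, depending only on $n$ and $\theta$, such that the following holds for every (complex-valued) $u_1\in L^2(\mathbf R^n)\cap L^{1,1}(\mathbf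 R^n)$, i.e. $u_1\in L^2(\mathbf R^n)$ with $\|u_1\|_{1,1}:=\int_{\mathbf R^n}(1+|x|)|u_1(x)|\,dx<\infty$. Put $P_1=\int_{\mathbf R^n}u_1(x)\,dx$, $I_0=\|u_1\|_{1,1}+\|u_1\|_{L^2}$, and $$\rho_n(t)=\begin{cases}t^{-\frac{n-2}{4\theta}}, & n\ge3,\\ \sqrt{\log t}, & n=2,\\ \sqrt t, & n=1.\end{cases}$$ The problem has a unique mild solution $u$, and $$\|u(t,\cdot)\|_{L^2}\le C^{-1}I_0\,\rho_n(t)\quad\text{for all } t\ge T_0;$$ moreover there is $T_1\ge T_0$, which may depend on $u_1$, such that $$C\,|P_1|\,\rho_n(t)\le\|u(t,\cdot)\|_{L^2}\quad\text{for all } t\ge T_1.$$ -/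

import Mathlib

open MeasureTheory Set
open scoped FourierTransform SchwartzMap LineDeriv Laplacian ENNReal

noncomputable section

namespace LogDampedWave

/-- The space `ℝⁿ` with its Euclidean norm. -/
abbrev Rn (n : ℕ) : Type := EuclideanSpace ℝ (Fin n)

/-- The complex Hilbert space `L²(ℝⁿ)`; its norm is the `L²` norm. -/
abbrev L2 (n : ℕ) : Type := Lp (α := Rn n) ℂ 2 (volume : Measure (Rn n))

/-- The symbol `log (1 + |2πξ|^{2θ})`. Mathlib's Fourier transform is
`𝓕 f ξ = ∫ exp (-2πi x·ξ) f x dx = f̂ (2πξ)`, where `f̂ η = ∫ exp (-i x·η) f x dx`; thus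
multiplying `f̂ η` by `log (1 + |η|^{2θ})` is multiplying `𝓕 f ξ` by this symbol. -/
def logSymbol (n : ℕ) (θ : ℝ) (ξ : Rn n) : ℝ :=
  Real.log (1 + (2 * Real.pi * ‖ξ‖) ^ (2 * θ))

/-- The domain of `L_θ`: those `f ∈ L²` for which the product of the symbol and the
(Plancherel) Fourier transform of `f` is square integrable. -/
def logOpDomain (n : ℕ) (θ : ℝ) : Set (L2 n) :=
  {f | MemLp (fun ξ => (logSymbol n θ ξ : ℂ) * (𝓕 f : L2 n) ξ) 2 volume}

/-- The operator `L_θ = log (I + (-Δ)^θ)` on its domain: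
`L_θ f = 𝓕⁻¹ (log (1 + |η|^{2θ}) f̂)`. -/
def logOp (n : ℕ) (θ : ℝ) (f : L2 n) (hf : f ∈ logOpDomain n θ) : L2 n :=
  𝓕⁻ (MemLp.toLp (fun ξ => (logSymbol n θ ξ : ℂ) * (𝓕 f : L2 n) ξ) hf)

/-- `u ∈ C([0,∞); H¹(ℝⁿ))`: `u` is continuous into `L²`, and so are its first partial derivatives,
taken in the sense of distributions. -/
def ContinuousInH1 (n : ℕ) (u : ℝ → L2 n) : Prop :=
  ContinuousOn u (Ici 0) ∧
    ∀ j : Fin n, ∃ g : ℝ → L2 n, ContinuousOn g (Ici 0) ∧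
      ∀ t, 0 ≤ t →
        ∂_{EuclideanSpace.single j (1 : ℝ)} (u t : 𝓢'(Rn n, ℂ)) = (g t : 𝓢'(Rn n, ℂ))

/-- `u ∈ C([0,∞); H¹) ∩ C¹([0,∞); L²)` is a mild solution of
`u_tt - Δ u + L_θ u_t = 0`, `u(0) = 0`, `u_t(0) = u₁`. Values of `u` at negative times are
irrelevant.

In terms of the first-order system `U' = 𝒜 U`, `U = (u, v)`, `𝒜 (u, v) = (v, Δ u - L_θ v)`, on
`H¹ × L²`, a mild solution is a continuous `U` such that `∫₀ᵗ U ds` lies in the domain of `𝒜` and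
`U(t) = U(0) + 𝒜 ∫₀ᵗ U ds` for all `t ≥ 0`. The first component says `v = u_t`. As
`∫₀ᵗ u_t ds = u(t)`, the second one is
`u_t(t) = u₁ + Δ ∫₀ᵗ u ds - L_θ u(t)`. The Laplacian is the distributional one; that
`Δ ∫₀ᵗ u ds` is in `L²` means that `∫₀ᵗ u ds` is in `H²`. -/
structure IsMildSolution (n : ℕ) (θ : ℝ) (u₁ : L2 n) (u : ℝ → L2 n) : Prop where
  initial : u 0 = 0
  continuousInH1 : ContinuousInH1 n u
  equation : ∃ v : ℝ → L2 n, ContinuousOn v (Ici 0) ∧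
    (∀ t, 0 ≤ t → HasDerivWithinAt u (v t) (Ici 0) t) ∧ v 0 = u₁ ∧
    ∀ t, 0 ≤ t → ∃ h : u t ∈ logOpDomain n θ,
      Δ ((∫ s in (0 : ℝ)..t, u s : L2 n) : 𝓢'(Rn n, ℂ)) =
        ((v t - u₁ + logOp n θ (u t) h : L2 n) : 𝓢'(Rn n, ℂ))

/-- `f ∈ L^{1,1}(ℝⁿ)`, that is `f ∈ L¹` and `∫ (1 + |x|) |f(x)| dx < ∞`. -/
def MemL11 (n : ℕ) (f : Rn n → ℂ) : Prop :=
  Integrable f ∧ Integrable (fun x => (1 + ‖x‖) * ‖f x‖)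

/-- `‖f‖_{1,1} = ∫ (1 + |x|) |f(x)| dx`. -/
def norm11 (n : ℕ) (f : Rn n → ℂ) : ℝ := ∫ x, (1 + ‖x‖) * ‖f x‖

/-- `I₀ = ‖u₁‖_{1,1} + ‖u₁‖_{L²}`. -/
def dataSize (n : ℕ) (u₁ : L2 n) : ℝ := norm11 n u₁ + ‖u₁‖

/-- `P₁ = ∫ u₁(x) dx`. -/
def mass (n : ℕ) (u₁ : L2 n) : ℂ := ∫ x, u₁ x

/-- `√t` for `n = 1`, `√(log t)` for `n = 2`, and `t^{-(n-2)/(4θ)}` for `n ≥ 3`. -/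
def rate (n : ℕ) (θ t : ℝ) : ℝ :=
  if n = 1 then √t
  else if n = 2 then √(Real.log t)
  else t ^ (-((n : ℝ) - 2) / (4 * θ))

end LogDampedWave

end

/-!
The argument takes place on the Fourier side. With `r = |η|` and `ℓ = log (1 + r^{2θ})` the equation
is the damped oscillator `m'' + ℓ m' + r² m = 0` at each frequency, and `û(t) = m(t, r) û₁`, where
`m(0) = 0`, `m'(0) = 1`; explicitly `m = e^{-ℓt/2} sin(ωt)/ω`, `ω² = r² - ℓ²/4`, with a hyperbolic
sine in the overdamped range.

*Well-posedness.* The energy `m'² + r² m²` is nonincreasing, so `m'` and `r m` are bounded by `1`,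
and `ℓ m` is bounded because `ℓ ≤ (1 + 2θ) r`. By dominated convergence these bounds turn the
pointwise facts about `m` into continuity and differentiability in `L²`, and
`r² ∫₀ᵗ m = 1 - m' - ℓ m` is the integrated equation (`isMildSolution_waveSol`). Conversely, after
truncation to `|η| ≤ R` the pair `(∫₀ᵗ w, w)` formed from any mild solution `w` solves a linear
differential equation with a bounded generator, hence is unique (`IsMildSolution.unique`).

*Rates.* By Plancherel `‖u(t)‖² = ∫ m² |û₁|²` up to a constant. Frequencies `r ≥ 1` decay
exponentially, uniformly in `r` (`exists_osc_highFrequency_decay`). For `r ≤ 1` the condition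
`θ > 1/2` gives `ℓ ≤ r^{2θ} ≤ r`, so that `m` oscillates with `ω ≈ r`, and `m²` behaves like
`e^{-ℓt} sin²(rt)/r²`, where `r^{2θ}/2 ≤ ℓ ≤ r^{2θ}`. There `|û₁|` is at most `‖u₁‖_{L¹}`, and at
least `|P₁|/2` near the origin, because the Plancherel transform of an integrable function is its
(continuous) Fourier integral. In polar coordinates it remains to show that
`∫₀ r^{n-1} m² dr` is comparable to the square of the rate. From above
(`exists_integral_density_le`), the Gamma integral of `r^{n-3} e^{-r^{2θ} t/2}` serves for `n ≥ 3`,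
and the interpolated bound `m² ≤ 2t²/(1 + t²r²)` for `n = 1, 2`. From below
(`exists_integral_density_ge`), only `r ≤ t^{-1/(2θ)}` is used, where the exponential factor is of
order one. For `n = 1` one has `m ≥ t/4` for `r ≤ 1/t`. For `n ≥ 2` the integral of `sin²(rt)/r`
over `a ≤ r ≤ b` is `½ log (b/a)` up to an error `O(1/(ta))`; with `b = t^{-1/(2θ)}`, take `a = 1/t`
if `n = 2` and `a = b/2` if `n ≥ 3`. Replacing `ω` by `r` costs at most `t b^{4θ-1} = b^{2θ-1}`.
-/

noncomputable section

namespace LogDampedWave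

open Filter Topology

/-! ### Multiplication by bounded symbols on `L²` -/

section Multiplication

variable {α : Type*} [MeasurableSpace α] {μ : Measure α}

theorem norm_sq_eq_integral (f : Lp (α := α) ℂ 2 μ) : ‖f‖ ^ 2 = ∫ x, ‖f x‖ ^ 2 ∂μ := by
  have h := L2.inner_def (𝕜 := ℂ) f f
  rw [inner_self_eq_norm_sq_to_K] at h
  simp only [inner_self_eq_norm_sq_to_K] at h
  have h2 : ((∫ x, ‖f x‖ ^ 2 ∂μ : ℝ) : ℂ) = ∫ x, ((‖f x‖ : ℂ)) ^ 2 ∂μ := by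
    rw [← integral_complex_ofReal]
    simp
  have h3 : ((‖f‖ ^ 2 : ℝ) : ℂ) = ((∫ x, ‖f x‖ ^ 2 ∂μ : ℝ) : ℂ) := by
    rw [h2]
    simpa using h
  exact_mod_cast h3

theorem integrable_norm_sq (f : Lp (α := α) ℂ 2 μ) : Integrable (fun x => ‖f x‖ ^ 2) μ := by
  simpa using (Lp.memLp f).integrable_norm_rpow (by simp) (by simp)

open Classical in
/-- Multiplication of an `L²` function by a symbol `φ`; it is zero by convention when the product
is not square integrable. -/
def mulL2 (φ : α → ℂ) (f : Lp (α := α) ℂ 2 μ) : Lp (α := α) ℂ 2 μ :=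
  if h : MemLp (fun x => φ x * f x) 2 μ then h.toLp else 0

theorem memLp_mul {φ : α → ℂ} {K : ℝ} (hφ : Measurable φ) (hK : ∀ x, ‖φ x‖ ≤ K)
    (f : Lp (α := α) ℂ 2 μ) : MemLp (fun x => φ x * f x) 2 μ := by
  refine (Lp.memLp f).of_le_mul (c := K)
    (hφ.aestronglyMeasurable.mul (Lp.aestronglyMeasurable f)) (ae_of_all _ fun x => ?_)
  rw [norm_mul]
  exact mul_le_mul_of_nonneg_right (hK x) (norm_nonneg _)

theorem coeFn_mulL2_of_memLp {φ : α → ℂ} {f : Lp (α := α) ℂ 2 μ}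
    (h : MemLp (fun x => φ x * f x) 2 μ) : mulL2 φ f =ᵐ[μ] fun x => φ x * f x := by
  rw [mulL2, dif_pos h]
  exact h.coeFn_toLp

theorem coeFn_mulL2 {φ : α → ℂ} {K : ℝ} (hφ : Measurable φ) (hK : ∀ x, ‖φ x‖ ≤ K)
    (f : Lp (α := α) ℂ 2 μ) : mulL2 φ f =ᵐ[μ] fun x => φ x * f x :=
  coeFn_mulL2_of_memLp (memLp_mul hφ hK f)

theorem mulL2_eq_of_ae {φ : α → ℂ} {f g : Lp (α := α) ℂ 2 μ}
    (h : g =ᵐ[μ] fun x => φ x * f x) : mulL2 φ f = g := by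
  have hm : MemLp (fun x => φ x * f x) 2 μ := (memLp_congr_ae h).1 (Lp.memLp g)
  exact Lp.ext ((coeFn_mulL2_of_memLp hm).trans h.symm)

/-- Dominated convergence for multiplication operators: if uniformly bounded symbols converge
almost everywhere, the products with a fixed `L²` function converge in `L²`. -/
theorem tendsto_mulL2 {ι : Type*} {l : Filter ι} [l.IsCountablyGenerated] {φ : ι → α → ℂ}
    {ψ : α → ℂ} {K : ℝ} (hφ : ∀ᶠ i in l, Measurable (φ i) ∧ ∀ x, ‖φ i x‖ ≤ K)
    (hψ : Measurable ψ) (hψK : ∀ x, ‖ψ x‖ ≤ K)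
    (hlim : ∀ᵐ x ∂μ, Tendsto (fun i => φ i x) l (𝓝 (ψ x))) (f : Lp (α := α) ℂ 2 μ) :
    Tendsto (fun i => mulL2 (φ i) f) l (𝓝 (mulL2 ψ f)) := by
  have key : Tendsto (fun i => ∫ x, ‖(φ i x - ψ x) * f x‖ ^ 2 ∂μ) l (𝓝 (∫ _, (0 : ℝ) ∂μ)) := by
    refine tendsto_integral_filter_of_dominated_convergence (fun x => (2 * K) ^ 2 * ‖f x‖ ^ 2)
      ?_ ?_ ((integrable_norm_sq f).const_mul _) ?_
    · filter_upwards [hφ] with i hi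
      exact (((hi.1.sub hψ).aestronglyMeasurable.mul (Lp.aestronglyMeasurable f)).norm.pow 2)
    · filter_upwards [hφ] with i hi
      refine ae_of_all _ fun x => ?_
      have h1 : ‖φ i x - ψ x‖ ≤ 2 * K :=
        (norm_sub_le _ _).trans (by linarith [hi.2 x, hψK x])
      rw [Real.norm_of_nonneg (by positivity), norm_mul, mul_pow]
      gcongr
    · filter_upwards [hlim] with x hx
      have h1 : Tendsto (fun i => ‖(φ i x - ψ x) * f x‖ ^ 2) l
          (𝓝 (‖(ψ x - ψ x) * f x‖ ^ 2)) :=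
        (((hx.sub_const (ψ x)).mul_const (f x)).norm).pow 2
      simpa using h1
  rw [tendsto_iff_norm_sub_tendsto_zero]
  have h2 : Tendsto (fun i => ‖mulL2 (φ i) f - mulL2 ψ f‖ ^ 2) l (𝓝 0) := by
    simp only [integral_zero] at key
    refine key.congr' ?_
    filter_upwards [hφ] with i hi
    rw [norm_sq_eq_integral]
    refine integral_congr_ae ?_
    filter_upwards [Lp.coeFn_sub (mulL2 (φ i) f) (mulL2 ψ f), coeFn_mulL2 hi.1 hi.2 f,
      coeFn_mulL2 hψ hψK f] with x h1 h2 h3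
    simp only [h1, Pi.sub_apply, h2, h3, sub_mul]
  have h3 := h2.sqrt
  simpa using h3

theorem mulL2_sub_symbol {φ ψ : α → ℂ} {K L : ℝ} (hφ : Measurable φ) (hK : ∀ x, ‖φ x‖ ≤ K)
    (hψ : Measurable ψ) (hL : ∀ x, ‖ψ x‖ ≤ L) (f : Lp (α := α) ℂ 2 μ) :
    mulL2 (fun x => φ x - ψ x) f = mulL2 φ f - mulL2 ψ f := by
  refine mulL2_eq_of_ae ?_
  filter_upwards [Lp.coeFn_sub (mulL2 φ f) (mulL2 ψ f), coeFn_mulL2 hφ hK f,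
    coeFn_mulL2 hψ hL f] with x h1 h2 h3
  simp only [h1, Pi.sub_apply, h2, h3, sub_mul]

theorem mulL2_const_mul {φ : α → ℂ} {K : ℝ} (hφ : Measurable φ) (hK : ∀ x, ‖φ x‖ ≤ K) (c : ℂ)
    (f : Lp (α := α) ℂ 2 μ) : mulL2 (fun x => c * φ x) f = c • mulL2 φ f := by
  refine mulL2_eq_of_ae ?_
  filter_upwards [Lp.coeFn_smul c (mulL2 φ f), coeFn_mulL2 hφ hK f] with x h1 h2
  simp only [h1, Pi.smul_apply, h2, smul_eq_mul, mul_assoc]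

/-- A path `t ↦ φ t · f` in `L²` is continuous when the symbols `φ t` are bounded and continuous
in `t`. -/
theorem continuousOn_mulL2 {φ : ℝ → α → ℂ} {K : ℝ} (hφ : ∀ t, 0 ≤ t → Measurable (φ t))
    (hK : ∀ t, 0 ≤ t → ∀ x, ‖φ t x‖ ≤ K) (hc : ∀ x, Continuous fun t => φ t x)
    (f : Lp (α := α) ℂ 2 μ) : ContinuousOn (fun t => mulL2 (φ t) f) (Ici 0) := by
  intro t ht
  refine tendsto_mulL2 (K := K) ?_ (hφ t ht) (hK t ht) ?_ f
  · filter_upwards [self_mem_nhdsWithin] with s hs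
    exact ⟨hφ s hs, hK s hs⟩
  · exact ae_of_all _ fun x => ((hc x).tendsto t).mono_left nhdsWithin_le_nhds

/-- A path `t ↦ φ t · f` in `L²` is differentiable with derivative `φ' t · f` when the symbols
are differentiable in `t` for almost every frequency, and `φ'` is bounded. -/
theorem hasDerivWithinAt_mulL2 {φ φ' : ℝ → α → ℂ} {T : ℝ} (K L : ℝ)
    (hφ : ∀ t, 0 ≤ t → Measurable (φ t))
    (hL : ∀ t ∈ Icc 0 T, ∀ x, ‖φ t x‖ ≤ L)
    (hφ' : ∀ t, 0 ≤ t → Measurable (φ' t)) (hK : ∀ t ∈ Icc 0 T, ∀ x, ‖φ' t x‖ ≤ K)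
    (hd : ∀ x, ∀ t, HasDerivAt (fun s => φ s x) (φ' t x) t)
    (f : Lp (α := α) ℂ 2 μ) {t : ℝ} (ht : t ∈ Ico 0 T) :
    HasDerivWithinAt (fun t => mulL2 (φ t) f) (mulL2 (φ' t) f) (Ici 0) t := by
  have ht' : t ∈ Icc 0 T := ⟨ht.1, ht.2.le⟩
  rw [hasDerivWithinAt_iff_tendsto_slope]
  have hev : ∀ᶠ s in 𝓝[Ici 0 \ {t}] t, s ∈ Icc 0 T := by
    have h1 : ∀ᶠ s in 𝓝[Ici 0 \ {t}] t, s < T :=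
      nhdsWithin_le_nhds (eventually_lt_nhds ht.2)
    filter_upwards [h1, self_mem_nhdsWithin] with s hs hs'
    exact ⟨hs'.1, hs.le⟩
  have hlim : Tendsto (fun s => mulL2 (fun x => ((s - t : ℝ) : ℂ)⁻¹ * (φ s x - φ t x)) f)
      (𝓝[Ici 0 \ {t}] t) (𝓝 (mulL2 (φ' t) f)) := by
    refine tendsto_mulL2 (K := K) ?_ (hφ' t ht.1) (hK t ht') ?_ f
    · filter_upwards [hev, self_mem_nhdsWithin] with s hs hs'
      refine ⟨((hφ s hs.1).sub (hφ t ht.1)).const_mul _, fun x => ?_⟩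
      have h1 : ‖φ s x - φ t x‖ ≤ K * ‖s - t‖ :=
        Convex.norm_image_sub_le_of_norm_hasDerivWithin_le (s := Icc 0 T)
          (fun y _ => (hd x y).hasDerivWithinAt) (fun y hy => hK y hy x) (convex_Icc 0 T) ht' hs
      have h2 : 0 < ‖s - t‖ := norm_pos_iff.2 (sub_ne_zero.2 hs'.2)
      rw [norm_mul, norm_inv, Complex.norm_real, inv_mul_le_iff₀ h2, mul_comm]
      exact h1
    · refine ae_of_all _ fun x => ?_
      have h1 := hasDerivWithinAt_iff_tendsto_slope.1 ((hd x t).hasDerivWithinAt (s := Ici 0))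
      refine h1.congr fun s => ?_
      rw [slope_def_module, ← Complex.ofReal_inv, Complex.real_smul]
  refine hlim.congr' ?_
  filter_upwards [hev] with s hs
  have hb : ∀ x, ‖φ s x - φ t x‖ ≤ L + L := fun x =>
    (norm_sub_le _ _).trans (add_le_add (hL s hs x) (hL t ht' x))
  rw [mulL2_const_mul (φ := fun x => φ s x - φ t x) ((hφ s hs.1).sub (hφ t ht.1)) hb,
    mulL2_sub_symbol (hφ s hs.1) (hL s hs) (hφ t ht.1) (hL t ht'), slope_def_module]
  rw [← Complex.ofReal_inv, Complex.coe_smul]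
  rfl

/-- Multiplication by a bounded measurable symbol as a bounded operator on `L²`. -/
def mulL2CLM (φ : α → ℂ) {K : ℝ} (hφ : Measurable φ) (hK : ∀ x, ‖φ x‖ ≤ K) :
    Lp (α := α) ℂ 2 μ →L[ℂ] Lp (α := α) ℂ 2 μ :=
  LinearMap.mkContinuous
    { toFun := mulL2 φ
      map_add' := fun f g => by
        refine mulL2_eq_of_ae ?_
        filter_upwards [Lp.coeFn_add (mulL2 φ f) (mulL2 φ g), coeFn_mulL2 hφ hK f,
          coeFn_mulL2 hφ hK g, Lp.coeFn_add f g] with x h1 h2 h3 h4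
        simp only [h1, h4, Pi.add_apply, h2, h3, mul_add]
      map_smul' := fun c f => by
        refine mulL2_eq_of_ae ?_
        filter_upwards [Lp.coeFn_smul c (mulL2 φ f), coeFn_mulL2 hφ hK f,
          Lp.coeFn_smul c f] with x h1 h2 h3
        simp only [RingHom.id_apply, h1, h3, Pi.smul_apply, h2, smul_eq_mul]
        ring } K fun f => by
    refine Lp.norm_le_mul_norm_of_ae_le_mul ?_
    filter_upwards [coeFn_mulL2 hφ hK f] with x hx
    rw [LinearMap.coe_mk, AddHom.coe_mk, hx, norm_mul]
    exact mul_le_mul_of_nonneg_right (hK x) (norm_nonneg _)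

theorem coeFn_mulL2CLM (φ : α → ℂ) {K : ℝ} (hφ : Measurable φ) (hK : ∀ x, ‖φ x‖ ≤ K)
    (f : Lp (α := α) ℂ 2 μ) : mulL2CLM φ hφ hK f =ᵐ[μ] fun x => φ x * f x :=
  coeFn_mulL2 hφ hK f

end Multiplication

/-! ### Distributional derivatives and the Fourier transform of `L²` functions -/

section Distributions

variable {n : ℕ}

theorem ae_eq_of_integral_schwartz_mul_eq {F G : Rn n → ℂ} (hF : LocallyIntegrable F)
    (hG : LocallyIntegrable G) (h : ∀ φ : 𝓢(Rn n, ℂ), ∫ x, φ x * F x = ∫ x, φ x * G x) :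
    F =ᵐ[volume] G := by
  refine ae_eq_of_integral_contDiff_smul_eq hF hG fun g g_smooth g_cpt => ?_
  have hg₁ : HasCompactSupport (Complex.ofRealCLM ∘ g) := g_cpt.comp_left rfl
  have hg₂ : ContDiff ℝ (⊤ : ℕ∞) (Complex.ofRealCLM ∘ g) :=
    Complex.ofRealCLM.contDiff.comp g_smooth
  simpa using h (hg₁.toSchwartzMap hg₂)

/-- A product of temperate growth with an `L²` function is an `L²` function in the sense of
distributions exactly when it is so pointwise. -/
theorem smulLeftCLM_eq_iff {g : Rn n → ℂ} (hg : g.HasTemperateGrowth) (F G : L2 n) :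
    TemperedDistribution.smulLeftCLM ℂ g (F : 𝓢'(Rn n, ℂ)) = (G : 𝓢'(Rn n, ℂ)) ↔
      G =ᵐ[volume] fun ξ => g ξ * F ξ := by
  have hF := (Lp.memLp F).locallyIntegrable (by norm_num)
  have hG := (Lp.memLp G).locallyIntegrable (by norm_num)
  constructor
  · intro h
    refine ae_eq_of_integral_schwartz_mul_eq hG ?_ fun φ => ?_
    · have hgc : Continuous g := hg.1.continuous
      exact (hF.continuous_smul hgc)
    · have h1 := DFunLike.congr_fun h φ
      simp only [TemperedDistribution.smulLeftCLM_apply_apply, Lp.toTemperedDistribution_apply,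
        SchwartzMap.smulLeftCLM_apply_apply hg, smul_eq_mul] at h1
      rw [← h1]
      exact integral_congr_ae (ae_of_all _ fun x => by ring)
  · intro h
    ext φ
    simp only [TemperedDistribution.smulLeftCLM_apply_apply, Lp.toTemperedDistribution_apply,
      SchwartzMap.smulLeftCLM_apply_apply hg, smul_eq_mul]
    refine integral_congr_ae ?_
    filter_upwards [h] with x hx
    rw [hx]
    ring

theorem fourierMultiplierCLM_eq_iff {g : Rn n → ℂ} (hg : g.HasTemperateGrowth) (W G : L2 n) :
    TemperedDistribution.fourierMultiplierCLM ℂ g (W : 𝓢'(Rn n, ℂ)) = (G : 𝓢'(Rn n, ℂ)) ↔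
      (𝓕 G : L2 n) =ᵐ[volume] fun ξ => g ξ * (𝓕 W : L2 n) ξ := by
  rw [← smulLeftCLM_eq_iff hg, ← Lp.fourier_toTemperedDistribution_eq,
    ← Lp.fourier_toTemperedDistribution_eq, TemperedDistribution.fourierMultiplierCLM_apply]
  constructor
  · intro h
    rw [← h, FourierTransform.fourier_fourierInv_eq]
  · intro h
    rw [h, FourierTransform.fourierInv_fourier_eq]

/-- The distributional Laplacian of `W ∈ L²` is `G ∈ L²` if and only if `-|η|² Ŵ = Ĝ`. -/
theorem laplacian_eq_iff (W G : L2 n) :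
    Δ (W : 𝓢'(Rn n, ℂ)) = (G : 𝓢'(Rn n, ℂ)) ↔
      (𝓕 G : L2 n) =ᵐ[volume] fun ξ => -((2 * Real.pi * ‖ξ‖ : ℝ) : ℂ) ^ 2 * (𝓕 W : L2 n) ξ := by
  have hg : (fun x : Rn n => Complex.ofReal (‖x‖ ^ 2)).HasTemperateGrowth := by fun_prop
  have hg' : (((-(2 * Real.pi) ^ 2 : ℝ) : ℂ) •
      fun x : Rn n => Complex.ofReal (‖x‖ ^ 2)).HasTemperateGrowth := by
    have := (Function.HasTemperateGrowth.const (E := Rn n)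
      (((-(2 * Real.pi) ^ 2 : ℝ) : ℂ))).mul hg
    exact this
  have h1 := fourierMultiplierCLM_eq_iff hg' W G
  rw [TemperedDistribution.fourierMultiplierCLM_smul hg] at h1
  rw [TemperedDistribution.laplacian_eq_fourierMultiplierCLM, ← Complex.coe_smul]
  refine h1.trans (Eq.to_iff ?_)
  congr 1
  ext ξ
  simp only [Pi.smul_apply, smul_eq_mul]
  push_cast
  ring

theorem lineDeriv_eq_iff (W G : L2 n) (e : Rn n) :
    ∂_{e} (W : 𝓢'(Rn n, ℂ)) = (G : 𝓢'(Rn n, ℂ)) ↔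
      (𝓕 G : L2 n) =ᵐ[volume]
        fun ξ => 2 * Real.pi * Complex.I * ((inner ℝ ξ e : ℝ) : ℂ) * (𝓕 W : L2 n) ξ := by
  have hg : (fun x : Rn n => Complex.ofReal (inner ℝ x e)).HasTemperateGrowth := by fun_prop
  have hg' : ((2 * Real.pi * Complex.I : ℂ) •
      fun x : Rn n => Complex.ofReal (inner ℝ x e)).HasTemperateGrowth :=
    (Function.HasTemperateGrowth.const (E := Rn n) (2 * Real.pi * Complex.I : ℂ)).mul hg
  have h1 := fourierMultiplierCLM_eq_iff hg' W G
  rw [TemperedDistribution.fourierMultiplierCLM_smul hg] at h1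
  rw [TemperedDistribution.lineDeriv_eq_fourierMultiplierCLM]
  exact h1

/-- On `L¹ ∩ L²` the Plancherel transform is the Fourier integral. -/
theorem fourier_ae_eq_fourierIntegral (f : L2 n) (hf : Integrable f) :
    (𝓕 f : L2 n) =ᵐ[volume] 𝓕 (f : Rn n → ℂ) := by
  refine ae_eq_of_integral_schwartz_mul_eq ((Lp.memLp _).locallyIntegrable (by norm_num))
    ?_ fun φ => ?_
  · exact (VectorFourier.fourierIntegral_continuous Real.continuous_fourierChar
      (L := innerₗ (Rn n)) continuous_inner hf).locallyIntegrable
  · have h1 := DFunLike.congr_fun (Lp.fourier_toTemperedDistribution_eq f) φ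
    simp only [TemperedDistribution.fourier_apply, Lp.toTemperedDistribution_apply,
      smul_eq_mul] at h1
    rw [← h1]
    have h2 := VectorFourier.integral_fourierIntegral_smul_eq_flip (L := innerₗ (Rn n))
      (μ := volume) (ν := volume) Real.continuous_fourierChar continuous_inner
      φ.integrable hf
    simpa [SchwartzMap.fourier_coe] using! h2

end Distributions

/-! ### The damped oscillator -/

/-- The solution of `s'' + D s = 0`, `s(0) = 0`, `s'(0) = 1`, for `D` of any sign. -/
def oscSin (D t : ℝ) : ℝ :=
  if 0 < D then Real.sin (√D * t) / √D
  else if D < 0 then Real.sinh (√(-D) * t) / √(-D) else t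

/-- The derivative of `oscSin D`, which is the solution of `c'' + D c = 0`, `c(0) = 1`,
`c'(0) = 0`. -/
def oscCos (D t : ℝ) : ℝ :=
  if 0 < D then Real.cos (√D * t) else Real.cosh (√(-D) * t)

theorem hasDerivAt_oscSin (D t : ℝ) : HasDerivAt (oscSin D) (oscCos D t) t := by
  unfold oscSin oscCos
  rcases lt_trichotomy 0 D with h | h | h
  · have h0 : √D ≠ 0 := (Real.sqrt_pos.2 h).ne'
    simp only [h, if_true]
    have := (((hasDerivAt_id t).const_mul √D).sin).div_const √D
    simpa [h0] using this
  · subst h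
    simpa using! hasDerivAt_id t
  · have h0 : √(-D) ≠ 0 := (Real.sqrt_pos.2 (neg_pos.2 h)).ne'
    simp only [h, not_lt.2 h.le, if_true, if_false]
    have := (((hasDerivAt_id t).const_mul √(-D)).sinh).div_const √(-D)
    simpa [h0] using this

theorem hasDerivAt_oscCos (D t : ℝ) : HasDerivAt (oscCos D) (-D * oscSin D t) t := by
  unfold oscSin oscCos
  rcases lt_trichotomy 0 D with h | h | h
  · have h0 : √D ≠ 0 := (Real.sqrt_pos.2 h).ne'
    have h1 : √D * √D = D := Real.mul_self_sqrt h.le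
    simp only [h, if_true]
    have := ((hasDerivAt_id t).const_mul √D).cos
    convert! this using 1
    field_simp
    simp only [id]
    linear_combination (-Real.sin (√D * t)) * (pow_two √D ▸ h1 : √D ^ 2 = D).symm
  · subst h
    simpa using hasDerivAt_const t (1 : ℝ)
  · have h0 : √(-D) ≠ 0 := (Real.sqrt_pos.2 (neg_pos.2 h)).ne'
    have h1 : √(-D) * √(-D) = -D := Real.mul_self_sqrt (neg_pos.2 h).le
    simp only [h, not_lt.2 h.le, if_true, if_false]
    have := ((hasDerivAt_id t).const_mul √(-D)).cosh
    convert! this using 1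
    field_simp
    simp only [id]
    linear_combination (-Real.sinh (√(-D) * t)) * (pow_two √(-D) ▸ h1 : √(-D) ^ 2 = -D)

/-- The solution of `m'' + ℓ m' + r² m = 0`, `m(0) = 0`, `m'(0) = 1`. -/
def osc (ℓ r t : ℝ) : ℝ := Real.exp (-(ℓ * t / 2)) * oscSin (r ^ 2 - ℓ ^ 2 / 4) t

/-- The time derivative of `osc ℓ r`. -/
def oscDeriv (ℓ r t : ℝ) : ℝ :=
  Real.exp (-(ℓ * t / 2)) * (oscCos (r ^ 2 - ℓ ^ 2 / 4) t - ℓ / 2 * oscSin (r ^ 2 - ℓ ^ 2 / 4) t)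

theorem hasDerivAt_exp_damping (ℓ t : ℝ) : HasDerivAt (fun t => Real.exp (-(ℓ * t / 2)))
    (Real.exp (-(ℓ * t / 2)) * -(ℓ / 2)) t := by
  have h := ((((hasDerivAt_id t).const_mul ℓ).div_const 2).neg).exp
  simpa using! h

theorem hasDerivAt_osc (ℓ r t : ℝ) : HasDerivAt (osc ℓ r) (oscDeriv ℓ r t) t := by
  have h := (hasDerivAt_exp_damping ℓ t).mul (hasDerivAt_oscSin (r ^ 2 - ℓ ^ 2 / 4) t)
  convert! h using 1
  unfold oscDeriv
  ring

theorem hasDerivAt_oscDeriv (ℓ r t : ℝ) :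
    HasDerivAt (oscDeriv ℓ r) (-ℓ * oscDeriv ℓ r t - r ^ 2 * osc ℓ r t) t := by
  have h := (hasDerivAt_exp_damping ℓ t).mul ((hasDerivAt_oscCos (r ^ 2 - ℓ ^ 2 / 4) t).sub
    ((hasDerivAt_oscSin (r ^ 2 - ℓ ^ 2 / 4) t).const_mul (ℓ / 2)))
  convert! h using 1
  unfold oscDeriv osc
  simp only [Pi.sub_apply]
  ring

theorem continuous_osc (ℓ r : ℝ) : Continuous (osc ℓ r) :=
  continuous_iff_continuousAt.2 fun t => (hasDerivAt_osc ℓ r t).continuousAt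

theorem continuous_oscDeriv (ℓ r : ℝ) : Continuous (oscDeriv ℓ r) :=
  continuous_iff_continuousAt.2 fun t => (hasDerivAt_oscDeriv ℓ r t).continuousAt

@[simp]
theorem osc_zero (ℓ r : ℝ) : osc ℓ r 0 = 0 := by
  simp [osc, oscSin]

@[simp]
theorem oscDeriv_zero (ℓ r : ℝ) : oscDeriv ℓ r 0 = 1 := by
  simp [oscDeriv, oscSin, oscCos]

/-- The energy `m'² + r² m²` is nonincreasing, hence at most its initial value `1`. -/
theorem osc_energy_le {ℓ : ℝ} (hℓ : 0 ≤ ℓ) (r : ℝ) {t : ℝ} (ht : 0 ≤ t) :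
    oscDeriv ℓ r t ^ 2 + r ^ 2 * osc ℓ r t ^ 2 ≤ 1 := by
  have hd : ∀ t, HasDerivAt (fun t => oscDeriv ℓ r t ^ 2 + r ^ 2 * osc ℓ r t ^ 2)
      (-2 * ℓ * oscDeriv ℓ r t ^ 2) t := fun t => by
    have h := ((hasDerivAt_oscDeriv ℓ r t).pow 2).add
      (((hasDerivAt_osc ℓ r t).pow 2).const_mul (r ^ 2))
    convert! h using 1
    simp only [Nat.cast_ofNat]
    ring
  have h1 := antitone_of_deriv_nonpos (fun t => (hd t).differentiableAt) (fun t => by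
    rw [(hd t).deriv]
    have := mul_nonneg hℓ (sq_nonneg (oscDeriv ℓ r t))
    linarith)
  simpa using h1 ht

theorem abs_oscDeriv_le {ℓ : ℝ} (hℓ : 0 ≤ ℓ) (r : ℝ) {t : ℝ} (ht : 0 ≤ t) :
    |oscDeriv ℓ r t| ≤ 1 := by
  rw [← sq_le_one_iff_abs_le_one]
  nlinarith [osc_energy_le hℓ r ht, sq_nonneg (r * osc ℓ r t)]

theorem abs_mul_osc_le {ℓ : ℝ} (hℓ : 0 ≤ ℓ) (r : ℝ) {t : ℝ} (ht : 0 ≤ t) :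
    |r * osc ℓ r t| ≤ 1 := by
  rw [← sq_le_one_iff_abs_le_one]
  nlinarith [osc_energy_le hℓ r ht, sq_nonneg (oscDeriv ℓ r t)]

theorem abs_osc_le {ℓ : ℝ} (hℓ : 0 ≤ ℓ) (r : ℝ) {t : ℝ} (ht : 0 ≤ t) :
    |osc ℓ r t| ≤ t := by
  have h := Convex.norm_image_sub_le_of_norm_hasDerivWithin_le (s := Ici 0) (C := 1)
    (fun y _ => (hasDerivAt_osc ℓ r y).hasDerivWithinAt)
    (fun y hy => by rw [Real.norm_eq_abs]; exact abs_oscDeriv_le hℓ r hy) (convex_Ici 0)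
    (mem_Ici.2 le_rfl) (mem_Ici.2 ht)
  simpa [abs_of_nonneg ht] using h

/-- Interpolation between the bounds `|m| ≤ t` and `|r m| ≤ 1`. -/
theorem osc_sq_le {ℓ : ℝ} (hℓ : 0 ≤ ℓ) (r : ℝ) {t : ℝ} (ht : 0 ≤ t) :
    osc ℓ r t ^ 2 ≤ 2 * t ^ 2 / (1 + t ^ 2 * r ^ 2) := by
  rw [le_div_iff₀ (by positivity)]
  have h1 : osc ℓ r t ^ 2 ≤ t ^ 2 := sq_le_sq' (abs_le.1 (abs_osc_le hℓ r ht)).1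
    (abs_le.1 (abs_osc_le hℓ r ht)).2
  have h2 : r ^ 2 * osc ℓ r t ^ 2 ≤ 1 := by
    nlinarith [osc_energy_le hℓ r ht, sq_nonneg (oscDeriv ℓ r t)]
  nlinarith [mul_le_mul_of_nonneg_left h2 (sq_nonneg t)]

theorem sinh_le_mul_exp (x : ℝ) : Real.sinh x ≤ x * Real.exp x := by
  have h1 := Real.add_one_le_exp (-(2 * x))
  have h2 : Real.exp (-x) = Real.exp x * Real.exp (-(2 * x)) := by
    rw [← Real.exp_add]; ring_nf
  rw [Real.sinh_eq, h2]
  nlinarith [Real.exp_pos x]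

/-- Uniform exponential decay: `c` is a lower bound for `-Re λ`, where `λ` is a root of
`λ² + ℓ λ + r² = 0`. -/
theorem abs_osc_le_mul_exp {ℓ r c t : ℝ} (hc : c ≤ ℓ / 2) (hcr : c * ℓ ≤ r ^ 2) (ht : 0 ≤ t) :
    |osc ℓ r t| ≤ t * Real.exp (-c * t) := by
  have hdamp : Real.exp (-(ℓ * t / 2)) ≤ Real.exp (-c * t) := by
    apply Real.exp_le_exp.2
    nlinarith
  unfold osc oscSin
  rw [abs_mul, Real.abs_exp]
  rcases lt_trichotomy 0 (r ^ 2 - ℓ ^ 2 / 4) with h | h | h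
  · have h0 : 0 < √(r ^ 2 - ℓ ^ 2 / 4) := Real.sqrt_pos.2 h
    simp only [h, if_true]
    rw [abs_div, abs_of_pos h0, mul_comm t]
    refine mul_le_mul hdamp ?_ (by positivity) (Real.exp_pos _).le
    rw [div_le_iff₀ h0]
    refine Real.abs_sin_le_abs.trans ?_
    rw [abs_mul, abs_of_pos h0, abs_of_nonneg ht, mul_comm]
  · rw [← h]
    simp only [lt_irrefl, if_false]
    rw [abs_of_nonneg ht, mul_comm t]
    exact mul_le_mul_of_nonneg_right hdamp ht
  · -- Overdamped range: `c ≤ ℓ / 2 - k`, as `k ^ 2 = ℓ ^ 2 / 4 - r ^ 2 ≤ (ℓ / 2 - c) ^ 2`.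
    set k := √(-(r ^ 2 - ℓ ^ 2 / 4)) with hk
    have h0 : 0 < k := Real.sqrt_pos.2 (neg_pos.2 h)
    simp only [h, not_lt.2 h.le, if_true, if_false]
    rw [abs_div, abs_of_pos h0, Real.abs_sinh, abs_of_nonneg (mul_nonneg h0.le ht)]
    have h2 : k ≤ ℓ / 2 - c := by
      apply Real.sqrt_le_iff.2 ⟨by linarith, ?_⟩
      nlinarith [sq_nonneg c]
    have h3 : Real.sinh (k * t) / k ≤ t * Real.exp (k * t) := by
      rw [div_le_iff₀ h0]
      calc _ ≤ k * t * Real.exp (k * t) := sinh_le_mul_exp _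
        _ = _ := by ring
    calc _ ≤ Real.exp (-(ℓ * t / 2)) * (t * Real.exp (k * t)) := by gcongr
      _ = t * Real.exp (-(ℓ * t / 2) + k * t) := by rw [Real.exp_add]; ring
      _ ≤ _ := by
        gcongr
        nlinarith

/-- The damping coefficient `log (1 + r^{2θ})` as a function of the frequency `r = |η|`. -/
def damping (θ r : ℝ) : ℝ := Real.log (1 + r ^ (2 * θ))

theorem damping_zero {θ : ℝ} (hθ : 1 / 2 < θ) : damping θ 0 = 0 := by
  rw [damping, Real.zero_rpow (by linarith)]
  simp

theorem damping_nonneg {θ r : ℝ} (hr : 0 ≤ r) : 0 ≤ damping θ r :=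
  Real.log_nonneg (by linarith [Real.rpow_nonneg hr (2 * θ)])

theorem damping_le_rpow {θ r : ℝ} (hr : 0 ≤ r) : damping θ r ≤ r ^ (2 * θ) := by
  have h := Real.log_le_sub_one_of_pos (x := 1 + r ^ (2 * θ))
    (by linarith [Real.rpow_nonneg hr (2 * θ)])
  unfold damping
  linarith

theorem rpow_le_self {θ r : ℝ} (hθ : 1 / 2 < θ) (hr : 0 ≤ r) (hr1 : r ≤ 1) :
    r ^ (2 * θ) ≤ r := by
  rcases hr.eq_or_lt with rfl | hr0
  · rw [Real.zero_rpow (by linarith)]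
  · simpa using Real.rpow_le_rpow_of_exponent_ge hr0 hr1 (by linarith : (1 : ℝ) ≤ 2 * θ)

theorem rpow_div_two_le_damping {θ r : ℝ} (hθ : 1 / 2 < θ) (hr : 0 ≤ r) (hr1 : r ≤ 1) :
    r ^ (2 * θ) / 2 ≤ damping θ r := by
  have h0 := Real.rpow_nonneg hr (2 * θ)
  have h1 : r ^ (2 * θ) ≤ 1 := (rpow_le_self hθ hr hr1).trans hr1
  have h := Real.one_sub_inv_le_log_of_pos (x := 1 + r ^ (2 * θ)) (by linarith)
  refine le_trans ?_ h
  have h2 : 1 - (1 + r ^ (2 * θ))⁻¹ = r ^ (2 * θ) / (1 + r ^ (2 * θ)) := by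
    field_simp
    ring
  rw [h2]
  exact div_le_div_of_nonneg_left h0 (by linarith) (by linarith)

theorem damping_le_of_one_le {θ r : ℝ} (hθ : 1 / 2 < θ) (hr : 1 ≤ r) :
    damping θ r ≤ (1 + 2 * θ) * r := by
  have h1 : (1 : ℝ) ≤ r ^ (2 * θ) := Real.one_le_rpow hr (by linarith)
  have h2 : damping θ r ≤ Real.log (2 * r ^ (2 * θ)) :=
    Real.log_le_log (by linarith) (by linarith)
  rw [Real.log_mul (by norm_num) (by linarith), Real.log_rpow (by linarith)] at h2
  have h3 : Real.log r ≤ r := (Real.log_le_sub_one_of_pos (by linarith)).trans (by linarith)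
  have h4 : Real.log 2 ≤ 1 := by linarith [Real.log_two_lt_d9]
  nlinarith

theorem damping_le {θ r : ℝ} (hθ : 1 / 2 < θ) (hr : 0 ≤ r) :
    damping θ r ≤ (1 + 2 * θ) * r := by
  rcases le_total r 1 with h | h
  · have := (damping_le_rpow hr).trans (rpow_le_self hθ hr h)
    nlinarith
  · exact damping_le_of_one_le hθ h

/-- Frequencies `r ≥ 1` decay exponentially, uniformly in `r`. -/
theorem exists_osc_highFrequency_decay {θ : ℝ} (hθ : 1 / 2 < θ) :
    ∃ c : ℝ, 0 < c ∧ ∀ r t : ℝ, 1 ≤ r → 0 ≤ t →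
      |osc (damping θ r) r t| ≤ t * Real.exp (-c * t) := by
  have hl : 0 < Real.log 2 := Real.log_pos (by norm_num)
  refine ⟨min (Real.log 2 / 2) (1 / (1 + 2 * θ)),
    lt_min (by linarith) (by have : 0 < 1 + 2 * θ := by linarith
                             positivity), fun r t hr ht => abs_osc_le_mul_exp ?_ ?_ ht⟩
  · refine (min_le_left _ _).trans ?_
    have : Real.log 2 ≤ damping θ r := Real.log_le_log (by norm_num) (by
      linarith [Real.one_le_rpow hr (by linarith : (0 : ℝ) ≤ 2 * θ)])
    linarith
  · have h0 : 0 < 1 + 2 * θ := by linarith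
    calc _ ≤ 1 / (1 + 2 * θ) * ((1 + 2 * θ) * r) :=
          mul_le_mul (min_le_right _ _) (damping_le_of_one_le hθ hr)
            (damping_nonneg (by linarith)) (by positivity)
      _ = r := by field_simp
      _ ≤ r ^ 2 := by nlinarith

/-- Since `2θ > 1`, the damping is at most `r` for `r ≤ 1`, so that low frequencies oscillate. -/
theorem three_quarters_sq_le {θ r : ℝ} (hθ : 1 / 2 < θ) (hr : 0 ≤ r) (hr1 : r ≤ 1) :
    3 / 4 * r ^ 2 ≤ r ^ 2 - damping θ r ^ 2 / 4 := by
  have h1 := (damping_le_rpow hr).trans (rpow_le_self hθ hr hr1)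
  have h2 := damping_nonneg (θ := θ) hr
  nlinarith

theorem osc_sq_eq_of_pos {ℓ r t : ℝ} (h : 0 < r ^ 2 - ℓ ^ 2 / 4) :
    osc ℓ r t ^ 2 = Real.exp (-(ℓ * t)) *
      (Real.sin (√(r ^ 2 - ℓ ^ 2 / 4) * t) ^ 2 / (r ^ 2 - ℓ ^ 2 / 4)) := by
  unfold osc oscSin
  simp only [h, if_true]
  rw [mul_pow, div_pow, Real.sq_sqrt h.le, ← Real.exp_nat_mul]
  congr 2
  push_cast
  ring

theorem osc_sq_le_lowFrequency {θ r t : ℝ} (hθ : 1 / 2 < θ) (hr : 0 < r) (hr1 : r ≤ 1)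
    (ht : 0 ≤ t) :
    osc (damping θ r) r t ^ 2 ≤ 2 * r ^ (-2 : ℝ) * Real.exp (-(t / 2) * r ^ (2 * θ)) := by
  have h1 := three_quarters_sq_le hθ hr.le hr1
  have h2 : 0 < r ^ 2 - damping θ r ^ 2 / 4 := by
    have := pow_pos hr 2
    linarith
  rw [osc_sq_eq_of_pos h2, mul_comm]
  refine mul_le_mul ?_ ?_ (Real.exp_pos _).le (by positivity)
  · rw [div_le_iff₀ h2, Real.rpow_neg hr.le, Real.rpow_two]
    refine (Real.sin_sq_le_one _).trans ?_
    calc (1 : ℝ) ≤ 2 * (r ^ 2)⁻¹ * (3 / 4 * r ^ 2) := by field_simp; norm_num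
      _ ≤ _ := by gcongr
  · apply Real.exp_le_exp.2
    nlinarith [rpow_div_two_le_damping hθ hr.le hr1]

/-- Below frequency `1` the phase `√(r² - ℓ²/4)` differs little from `r`, because
`ℓ ≤ r^{2θ}`. -/
theorem sub_sqrt_le {θ r : ℝ} (hθ : 1 / 2 < θ) (hr : 0 < r) (hr1 : r ≤ 1) :
    |√(r ^ 2 - damping θ r ^ 2 / 4) - r| ≤ r ^ (4 * θ - 1) / 4 := by
  have h1 := three_quarters_sq_le hθ hr.le hr1
  set D := r ^ 2 - damping θ r ^ 2 / 4 with hD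
  have hD0 : 0 ≤ D := by
    have := pow_pos hr 2
    linarith
  have h3 : √D ≤ r := by
    rw [Real.sqrt_le_left hr.le, hD]
    linarith [sq_nonneg (damping θ r)]
  have h4 : √D ^ 2 = D := Real.sq_sqrt hD0
  have h5 : damping θ r ^ 2 ≤ r ^ (4 * θ - 1) * r := by
    have h6 : r ^ (4 * θ - 1) * r = (r ^ (2 * θ)) ^ 2 := by
      rw [← Real.rpow_natCast, ← Real.rpow_mul hr.le, ← Real.rpow_add_one hr.ne']
      congr 1
      push_cast
      ring
    rw [h6]
    exact pow_le_pow_left₀ (damping_nonneg hr.le) (damping_le_rpow hr.le) 2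
  rw [abs_sub_comm, abs_of_nonneg (by linarith)]
  have h7 : (r - √D) * r ≤ r ^ (4 * θ - 1) / 4 * r := by
    nlinarith [Real.sqrt_nonneg D]
  exact le_of_mul_le_mul_right h7 hr

theorem abs_sin_sq_sub_sin_sq_le (x y : ℝ) :
    |Real.sin x ^ 2 - Real.sin y ^ 2| ≤ 2 * |x - y| := by
  have h1 : |Real.sin x - Real.sin y| ≤ |x - y| := Real.abs_sin_sub_sin_le x y
  have h2 : |Real.sin x + Real.sin y| ≤ 2 :=
    (abs_add_le _ _).trans (by linarith [Real.abs_sin_le_one x, Real.abs_sin_le_one y])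
  rw [sq_sub_sq, abs_mul]
  exact mul_le_mul h2 h1 (abs_nonneg _) (by norm_num)

/-- Lower bound for the profile in the oscillating regime, while the damping is still of
order one. -/
theorem osc_sq_ge {θ r t : ℝ} (hθ : 1 / 2 < θ) (hr : 0 < r) (hr1 : r ≤ 1) (ht : 0 ≤ t)
    (hrt : r ^ (2 * θ) * t ≤ 1) :
    Real.exp (-1) * (Real.sin (r * t) ^ 2 - t * r ^ (4 * θ - 1) / 2) ≤
      r ^ 2 * osc (damping θ r) r t ^ 2 := by
  have h1 := three_quarters_sq_le hθ hr.le hr1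
  have h2 : 0 < r ^ 2 - damping θ r ^ 2 / 4 := by
    have := pow_pos hr 2
    linarith
  have h3 := sub_sqrt_le hθ hr hr1
  rw [osc_sq_eq_of_pos h2]
  set D := r ^ 2 - damping θ r ^ 2 / 4 with hD
  have h4 : Real.sin (r * t) ^ 2 - t * r ^ (4 * θ - 1) / 2 ≤ Real.sin (√D * t) ^ 2 := by
    have h5 := (abs_le.1 (abs_sin_sq_sub_sin_sq_le (√D * t) (r * t))).1
    rw [← sub_mul, abs_mul, abs_of_nonneg ht] at h5
    nlinarith
  have h6 : Real.sin (√D * t) ^ 2 ≤ r ^ 2 * (Real.sin (√D * t) ^ 2 / D) := by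
    rw [mul_div_assoc', le_div_iff₀ h2, mul_comm]
    have : D ≤ r ^ 2 := by linarith [sq_nonneg (damping θ r)]
    gcongr
  have h7 : Real.exp (-1) ≤ Real.exp (-(damping θ r * t)) := by
    apply Real.exp_le_exp.2
    nlinarith [damping_le_rpow (θ := θ) hr.le]
  calc _ ≤ Real.exp (-1) * (r ^ 2 * (Real.sin (√D * t) ^ 2 / D)) := by
        gcongr
        exact h4.trans h6
    _ ≤ Real.exp (-(damping θ r * t)) * (r ^ 2 * (Real.sin (√D * t) ^ 2 / D)) := by
        gcongr
    _ = _ := by ring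

/-- Before the first oscillation, that is for `r t ≤ 1`, the profile is comparable to `t`. -/
theorem osc_ge_div_four {θ r t : ℝ} (hθ : 1 / 2 < θ) (hr : 0 < r) (hr1 : r ≤ 1) (ht : 0 < t)
    (hrt : r * t ≤ 1) : t / 4 ≤ osc (damping θ r) r t := by
  have h1 := three_quarters_sq_le hθ hr.le hr1
  have h2 : 0 < r ^ 2 - damping θ r ^ 2 / 4 := by
    have := pow_pos hr 2
    linarith
  unfold osc oscSin
  simp only [h2, if_true]
  set D := r ^ 2 - damping θ r ^ 2 / 4 with hD
  have h0 : 0 < √D := Real.sqrt_pos.2 h2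
  have h3 : √D ≤ r := by
    rw [Real.sqrt_le_left hr.le, hD]
    linarith [sq_nonneg (damping θ r)]
  have h4 : √D * t ≤ 1 := (mul_le_mul_of_nonneg_right h3 ht.le).trans hrt
  have h5 : t / 2 ≤ Real.sin (√D * t) / √D := by
    rw [le_div_iff₀ h0]
    have h6 := Real.mul_le_sin (x := √D * t) (by positivity) (by linarith [Real.pi_gt_three])
    refine le_trans ?_ h6
    have h7 : 1 / 2 ≤ 2 / Real.pi := by
      rw [div_le_div_iff₀ (by norm_num) Real.pi_pos]
      linarith [Real.pi_le_four]
    have h8 : 0 ≤ √D * t := by positivity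
    nlinarith
  have h6 : 1 / 2 ≤ Real.exp (-(damping θ r * t / 2)) := by
    have h7 := Real.add_one_le_exp (-(damping θ r * t / 2))
    have h8 : damping θ r * t ≤ 1 := (mul_le_mul_of_nonneg_right
      ((damping_le_rpow hr.le).trans (rpow_le_self hθ hr.le hr1)) ht.le).trans hrt
    linarith
  calc t / 4 = 1 / 2 * (t / 2) := by ring
    _ ≤ _ := mul_le_mul h6 h5 (by positivity) (Real.exp_pos _).le

theorem measurable_oscSin (t : ℝ) : Measurable fun D => oscSin D t := by
  unfold oscSin
  refine Measurable.ite measurableSet_Ioi (by fun_prop) ?_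
  exact Measurable.ite measurableSet_Iio (by fun_prop) measurable_const

theorem measurable_oscCos (t : ℝ) : Measurable fun D => oscCos D t := by
  unfold oscCos
  exact Measurable.ite measurableSet_Ioi (by fun_prop) (by fun_prop)

theorem measurable_damping (θ : ℝ) : Measurable (damping θ) := by
  unfold damping
  fun_prop

theorem measurable_osc_damping (θ t : ℝ) : Measurable fun r => osc (damping θ r) r t := by
  have h := measurable_damping θ
  have h1 := (measurable_oscSin t).comp (g := fun D => oscSin D t)
    (f := fun r => r ^ 2 - damping θ r ^ 2 / 4) (by fun_prop)
  unfold osc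
  exact Measurable.mul (by fun_prop) h1

theorem measurable_oscDeriv_damping (θ t : ℝ) :
    Measurable fun r => oscDeriv (damping θ r) r t := by
  have h := measurable_damping θ
  have h1 := (measurable_oscSin t).comp (g := fun D => oscSin D t)
    (f := fun r => r ^ 2 - damping θ r ^ 2 / 4) (by fun_prop)
  have h2 := (measurable_oscCos t).comp (g := fun D => oscCos D t)
    (f := fun r => r ^ 2 - damping θ r ^ 2 / 4) (by fun_prop)
  unfold oscDeriv
  exact Measurable.mul (by fun_prop) (h2.sub (Measurable.mul (by fun_prop) h1))

/-- The primitive `∫₀ᵗ osc (damping θ r) r`, in closed form. At `r = 0` there is no damping, the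
oscillator is `t`, and the primitive is `t² / 2`. -/
def oscPrim (θ r t : ℝ) : ℝ :=
  if r = 0 then t ^ 2 / 2
  else (1 - oscDeriv (damping θ r) r t - damping θ r * osc (damping θ r) r t) / r ^ 2

theorem sq_mul_oscPrim {θ : ℝ} (hθ : 1 / 2 < θ) (r t : ℝ) :
    r ^ 2 * oscPrim θ r t =
      1 - oscDeriv (damping θ r) r t - damping θ r * osc (damping θ r) r t := by
  unfold oscPrim
  split_ifs with h
  · subst h
    simp [damping_zero hθ, oscDeriv, oscCos]
  · field_simp

theorem hasDerivAt_oscPrim {θ : ℝ} (hθ : 1 / 2 < θ) (r t : ℝ) :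
    HasDerivAt (oscPrim θ r) (osc (damping θ r) r t) t := by
  unfold oscPrim
  by_cases h : r = 0
  · subst h
    simp only [if_true]
    have h1 := ((hasDerivAt_id t).pow 2).div_const 2
    convert! h1 using 1
    simp [damping_zero hθ, osc, oscSin]
  · simp only [h, if_false]
    have h1 := (((hasDerivAt_const t (1 : ℝ)).sub (hasDerivAt_oscDeriv (damping θ r) r t)).sub
      ((hasDerivAt_osc (damping θ r) r t).const_mul (damping θ r))).div_const (r ^ 2)
    convert! h1 using 1
    field_simp
    ring

@[simp]
theorem oscPrim_zero (θ r : ℝ) : oscPrim θ r 0 = 0 := by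
  simp [oscPrim]

theorem measurable_oscPrim (θ t : ℝ) : Measurable fun r => oscPrim θ r t := by
  have h := measurable_damping θ
  have h1 := measurable_osc_damping θ t
  have h2 := measurable_oscDeriv_damping θ t
  unfold oscPrim
  exact Measurable.ite (measurableSet_singleton 0) measurable_const (by fun_prop)

theorem abs_oscPrim_le {θ : ℝ} (hθ : 1 / 2 < θ) {r t T : ℝ} (hr : 0 ≤ r) (ht : 0 ≤ t)
    (htT : t ≤ T) : |oscPrim θ r t| ≤ T * T := by
  have h := Convex.norm_image_sub_le_of_norm_hasDerivWithin_le (s := Icc 0 T) (C := T)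
    (fun y _ => (hasDerivAt_oscPrim hθ r y).hasDerivWithinAt)
    (fun y hy => by
      rw [Real.norm_eq_abs]
      exact (abs_osc_le (damping_nonneg hr) r hy.1).trans hy.2) (convex_Icc 0 T)
    ⟨le_rfl, ht.trans htT⟩ ⟨ht, htT⟩
  simp only [oscPrim_zero, sub_zero, Real.norm_eq_abs, abs_of_nonneg ht] at h
  exact h.trans (mul_le_mul_of_nonneg_left htT (ht.trans htT))

/-! ### Existence of the mild solution -/

section Existence

variable {n : ℕ} {θ : ℝ}

/-- The frequency `|η| = 2π|ξ|` in Mathlib's normalization of the Fourier transform. -/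
def freq (ξ : Rn n) : ℝ := 2 * Real.pi * ‖ξ‖

theorem freq_nonneg (ξ : Rn n) : 0 ≤ freq ξ := by
  unfold freq
  positivity

@[fun_prop]
theorem measurable_freq : Measurable (freq (n := n)) := by
  unfold freq
  fun_prop

theorem logSymbol_eq (ξ : Rn n) : logSymbol n θ ξ = damping θ (freq ξ) := rfl

theorem measurable_damping_freq : Measurable fun ξ : Rn n => damping θ (freq ξ) :=
  (measurable_damping θ).comp measurable_freq

/-- The Fourier multiplier that maps `u₁` to `u(t)`. -/
def waveSymbol (θ t : ℝ) (ξ : Rn n) : ℂ := (osc (damping θ (freq ξ)) (freq ξ) t : ℂ)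

/-- The Fourier multiplier that maps `u₁` to `u_t(t)`. -/
def waveSymbolDeriv (θ t : ℝ) (ξ : Rn n) : ℂ := (oscDeriv (damping θ (freq ξ)) (freq ξ) t : ℂ)

/-- The Fourier multiplier that maps `u₁` to `∫₀ᵗ u`. -/
def waveSymbolPrim (θ t : ℝ) (ξ : Rn n) : ℂ := (oscPrim θ (freq ξ) t : ℂ)

theorem measurable_waveSymbol (t : ℝ) : Measurable (waveSymbol (n := n) θ t) :=
  Complex.measurable_ofReal.comp ((measurable_osc_damping θ t).comp measurable_freq)

theorem measurable_waveSymbolDeriv (t : ℝ) : Measurable (waveSymbolDeriv (n := n) θ t) :=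
  Complex.measurable_ofReal.comp ((measurable_oscDeriv_damping θ t).comp measurable_freq)

theorem measurable_waveSymbolPrim (t : ℝ) : Measurable (waveSymbolPrim (n := n) θ t) :=
  Complex.measurable_ofReal.comp ((measurable_oscPrim θ t).comp measurable_freq)

theorem norm_waveSymbol_le {t : ℝ} (ht : 0 ≤ t) (ξ : Rn n) : ‖waveSymbol θ t ξ‖ ≤ t := by
  rw [waveSymbol, Complex.norm_real]
  exact abs_osc_le (damping_nonneg (freq_nonneg ξ)) _ ht

theorem norm_freq_mul_waveSymbol_le {t : ℝ} (ht : 0 ≤ t) (ξ : Rn n) :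
    ‖(freq ξ : ℂ) * waveSymbol θ t ξ‖ ≤ 1 := by
  rw [waveSymbol, ← Complex.ofReal_mul, Complex.norm_real]
  exact abs_mul_osc_le (damping_nonneg (freq_nonneg ξ)) _ ht

theorem norm_waveSymbolDeriv_le {t : ℝ} (ht : 0 ≤ t) (ξ : Rn n) :
    ‖waveSymbolDeriv θ t ξ‖ ≤ 1 := by
  rw [waveSymbolDeriv, Complex.norm_real]
  exact abs_oscDeriv_le (damping_nonneg (freq_nonneg ξ)) _ ht

theorem norm_waveSymbolPrim_le (hθ : 1 / 2 < θ) {t T : ℝ} (ht : 0 ≤ t) (htT : t ≤ T)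
    (ξ : Rn n) : ‖waveSymbolPrim θ t ξ‖ ≤ T * T := by
  rw [waveSymbolPrim, Complex.norm_real]
  exact abs_oscPrim_le hθ (freq_nonneg ξ) ht htT

/-- `u(t) = 𝓕⁻ (m(t, ·) 𝓕 u₁)`, where `m(t, ·)` solves the damped oscillator at each frequency.
Only `t ≥ 0` is meaningful. -/
def waveSol (θ : ℝ) (u₁ : L2 n) (t : ℝ) : L2 n := 𝓕⁻ (mulL2 (waveSymbol θ t) (𝓕 u₁ : L2 n))

/-- The velocity `u_t(t)` of `waveSol`. -/
def waveVel (θ : ℝ) (u₁ : L2 n) (t : ℝ) : L2 n :=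
  𝓕⁻ (mulL2 (waveSymbolDeriv θ t) (𝓕 u₁ : L2 n))

theorem fourier_waveSol (u₁ : L2 n) (t : ℝ) :
    (𝓕 (waveSol θ u₁ t) : L2 n) = mulL2 (waveSymbol θ t) (𝓕 u₁ : L2 n) :=
  FourierTransform.fourier_fourierInv_eq _

theorem coeFn_fourier_waveSol (u₁ : L2 n) {t : ℝ} (ht : 0 ≤ t) :
    (𝓕 (waveSol θ u₁ t) : L2 n) =ᵐ[volume] fun ξ => waveSymbol θ t ξ * (𝓕 u₁ : L2 n) ξ := by
  rw [fourier_waveSol]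
  exact coeFn_mulL2 (measurable_waveSymbol t) (norm_waveSymbol_le ht) _

theorem waveSol_zero (u₁ : L2 n) : waveSol θ u₁ 0 = 0 := by
  have h : mulL2 (waveSymbol θ 0) (𝓕 u₁ : L2 n) = 0 := by
    refine mulL2_eq_of_ae ?_
    filter_upwards [Lp.coeFn_zero ℂ 2 (volume : Measure (Rn n))] with ξ hξ
    rw [hξ]
    simp [waveSymbol]
  rw [waveSol, h]
  exact (FourierTransform.fourierInvCLM ℂ (L2 n)).map_zero

theorem waveVel_zero (u₁ : L2 n) : waveVel θ u₁ 0 = u₁ := by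
  have h : mulL2 (waveSymbolDeriv θ 0) (𝓕 u₁ : L2 n) = (𝓕 u₁ : L2 n) := by
    exact mulL2_eq_of_ae (ae_of_all _ fun _ => by simp [waveSymbolDeriv])
  rw [waveVel, h]
  exact FourierTransform.fourierInv_fourier_eq _

theorem hasDerivAt_waveSymbol (ξ : Rn n) (t : ℝ) :
    HasDerivAt (fun s => waveSymbol θ s ξ) (waveSymbolDeriv θ t ξ) t :=
  (hasDerivAt_osc (damping θ (freq ξ)) (freq ξ) t).ofReal_comp

theorem hasDerivAt_waveSymbolPrim (hθ : 1 / 2 < θ) (ξ : Rn n) (t : ℝ) :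
    HasDerivAt (fun s => waveSymbolPrim θ s ξ) (waveSymbol θ t ξ) t :=
  (hasDerivAt_oscPrim hθ (freq ξ) t).ofReal_comp

theorem hasDerivWithinAt_waveSol (u₁ : L2 n) {t : ℝ} (ht : 0 ≤ t) :
    HasDerivWithinAt (waveSol θ u₁) (waveVel θ u₁ t) (Ici 0) t := by
  have h := hasDerivWithinAt_mulL2 (T := t + 1) (μ := volume) 1 (t + 1)
    (fun t _ => measurable_waveSymbol (n := n) (θ := θ) t)
    (fun s hs ξ => (norm_waveSymbol_le hs.1 ξ).trans hs.2)
    (fun t _ => measurable_waveSymbolDeriv t) (fun s hs ξ => norm_waveSymbolDeriv_le hs.1 ξ)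
    hasDerivAt_waveSymbol (𝓕 u₁ : L2 n) ⟨ht, by linarith⟩
  exact ((FourierTransform.fourierInvCLM ℂ (L2 n)).restrictScalars
    ℝ).hasFDerivAt.comp_hasDerivWithinAt t h

theorem continuousOn_waveSol (u₁ : L2 n) : ContinuousOn (waveSol θ u₁) (Ici 0) :=
  fun _ ht => (hasDerivWithinAt_waveSol u₁ ht).continuousWithinAt

theorem continuousOn_waveVel (u₁ : L2 n) : ContinuousOn (waveVel θ u₁) (Ici 0) :=
  (FourierTransform.fourierInvCLM ℂ (L2 n)).continuous.comp_continuousOn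
    (continuousOn_mulL2 (fun t _ => measurable_waveSymbolDeriv t)
      (fun _ ht => norm_waveSymbolDeriv_le ht)
      (fun _ => Complex.continuous_ofReal.comp (continuous_oscDeriv _ _)) _)

theorem intervalIntegral_waveSol (hθ : 1 / 2 < θ) (u₁ : L2 n) {t : ℝ} (ht : 0 ≤ t) :
    ∫ s in (0 : ℝ)..t, waveSol θ u₁ s =
      (𝓕⁻ (mulL2 (waveSymbolPrim θ t) (𝓕 u₁ : L2 n)) : L2 n) := by
  have hd : ∀ s, 0 ≤ s → HasDerivWithinAt
      (fun s => (𝓕⁻ (mulL2 (waveSymbolPrim θ s) (𝓕 u₁ : L2 n)) : L2 n))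
      (waveSol θ u₁ s) (Ici 0) s := by
    intro s hs
    have h := hasDerivWithinAt_mulL2 (T := s + 1) (μ := volume) (s + 1) ((s + 1) * (s + 1))
      (fun t _ => measurable_waveSymbolPrim (n := n) (θ := θ) t)
      (fun s hs ξ => norm_waveSymbolPrim_le hθ hs.1 hs.2 ξ)
      (fun t _ => measurable_waveSymbol t) (fun s hs ξ => (norm_waveSymbol_le hs.1 ξ).trans hs.2)
      (hasDerivAt_waveSymbolPrim hθ) (𝓕 u₁ : L2 n) ⟨hs, by linarith⟩
    exact ((FourierTransform.fourierInvCLM ℂ (L2 n)).restrictScalars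
      ℝ).hasFDerivAt.comp_hasDerivWithinAt s h
  have h0 : (𝓕⁻ (mulL2 (waveSymbolPrim θ 0) (𝓕 u₁ : L2 n)) : L2 n) = 0 := by
    have h : mulL2 (waveSymbolPrim θ 0) (𝓕 u₁ : L2 n) = 0 := by
      refine mulL2_eq_of_ae ?_
      filter_upwards [Lp.coeFn_zero ℂ 2 (volume : Measure (Rn n))] with ξ hξ
      rw [hξ]
      simp [waveSymbolPrim]
    rw [h]
    exact (FourierTransform.fourierInvCLM ℂ (L2 n)).map_zero
  have h := intervalIntegral.integral_eq_sub_of_hasDerivAt_of_le ht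
    (f := fun s => (𝓕⁻ (mulL2 (waveSymbolPrim θ s) (𝓕 u₁ : L2 n)) : L2 n))
    (fun s hs => (hd s hs.1).continuousWithinAt.mono Icc_subset_Ici_self)
    (fun s hs => (hd s hs.1.le).hasDerivAt (Ici_mem_nhds hs.1))
    (((continuousOn_waveSol u₁).mono (by
      rw [uIcc_of_le ht]; exact Icc_subset_Ici_self)).intervalIntegrable)
  rw [h, h0, sub_zero]

theorem norm_two_pi_inner_le (ξ : Rn n) (j : Fin n) :
    ‖(2 * Real.pi * Complex.I * ((inner ℝ ξ (EuclideanSpace.single j (1 : ℝ)) : ℝ) : ℂ) : ℂ)‖ ≤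
      ‖(freq ξ : ℂ)‖ := by
  have h : |inner ℝ ξ (EuclideanSpace.single j (1 : ℝ))| ≤ ‖ξ‖ := by
    simpa using abs_real_inner_le_norm ξ (EuclideanSpace.single j (1 : ℝ))
  rw [Complex.norm_real, Real.norm_of_nonneg (freq_nonneg ξ), freq]
  simp only [norm_mul, Complex.norm_ofNat, Complex.norm_real, Complex.norm_I,
    Real.norm_of_nonneg Real.pi_pos.le, mul_one, Real.norm_eq_abs]
  gcongr

theorem continuousInH1_waveSol (u₁ : L2 n) : ContinuousInH1 n (waveSol θ u₁) := by
  refine ⟨continuousOn_waveSol u₁, fun j => ?_⟩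
  set d : Rn n → ℂ := fun ξ =>
    2 * Real.pi * Complex.I * ((inner ℝ ξ (EuclideanSpace.single j (1 : ℝ)) : ℝ) : ℂ) with hd
  have hm : ∀ t, Measurable fun ξ => d ξ * waveSymbol θ t ξ := fun t => by
    have h1 : Measurable d := by
      refine Continuous.measurable ?_
      fun_prop
    exact h1.mul (measurable_waveSymbol t)
  have hb : ∀ t, 0 ≤ t → ∀ ξ, ‖d ξ * waveSymbol θ t ξ‖ ≤ 1 := fun t ht ξ => by
    refine le_trans ?_ (norm_freq_mul_waveSymbol_le (θ := θ) ht ξ)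
    rw [norm_mul (d ξ), norm_mul (freq ξ : ℂ)]
    exact mul_le_mul_of_nonneg_right (norm_two_pi_inner_le ξ j)
      (norm_nonneg (waveSymbol θ t ξ))
  refine ⟨fun t => 𝓕⁻ (mulL2 (fun ξ => d ξ * waveSymbol θ t ξ) (𝓕 u₁ : L2 n)), ?_, ?_⟩
  · refine (FourierTransform.fourierInvCLM ℂ (L2 n)).continuous.comp_continuousOn
      (continuousOn_mulL2 (fun t _ => hm t) hb (fun ξ => ?_) _)
    exact continuous_const.mul (Complex.continuous_ofReal.comp (continuous_osc _ _))
  · intro t ht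
    rw [lineDeriv_eq_iff, FourierTransform.fourier_fourierInv_eq]
    filter_upwards [coeFn_mulL2 (hm t) (hb t ht) (𝓕 u₁ : L2 n),
      coeFn_fourier_waveSol (θ := θ) u₁ ht] with ξ h1 h2
    rw [h1, h2, hd, mul_assoc]

theorem norm_logSymbol_mul_waveSymbol_le (hθ : 1 / 2 < θ) {t : ℝ} (ht : 0 ≤ t) (ξ : Rn n) :
    ‖(logSymbol n θ ξ : ℂ) * waveSymbol θ t ξ‖ ≤ 1 + 2 * θ := by
  rw [norm_mul, Complex.norm_real, logSymbol_eq,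
    Real.norm_of_nonneg (damping_nonneg (freq_nonneg ξ))]
  have h1 := norm_freq_mul_waveSymbol_le (θ := θ) ht ξ
  rw [norm_mul, Complex.norm_real, Real.norm_of_nonneg (freq_nonneg ξ)] at h1
  calc _ ≤ (1 + 2 * θ) * freq ξ * ‖waveSymbol θ t ξ‖ := by
        gcongr
        exact damping_le hθ (freq_nonneg ξ)
    _ ≤ _ := by nlinarith

theorem waveSol_mem_logOpDomain (hθ : 1 / 2 < θ) (u₁ : L2 n) {t : ℝ} (ht : 0 ≤ t) :
    waveSol θ u₁ t ∈ logOpDomain n θ := by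
  have hm : Measurable fun ξ : Rn n => (logSymbol n θ ξ : ℂ) * waveSymbol θ t ξ :=
    (Complex.measurable_ofReal.comp measurable_damping_freq).mul (measurable_waveSymbol t)
  refine (memLp_congr_ae ?_).1
    (memLp_mul hm (norm_logSymbol_mul_waveSymbol_le hθ ht) (𝓕 u₁ : L2 n))
  filter_upwards [coeFn_fourier_waveSol (θ := θ) u₁ ht] with ξ h
  rw [h, mul_assoc]

theorem coeFn_fourier_logOp {f : L2 n} (hf : f ∈ logOpDomain n θ) :
    (𝓕 (logOp n θ f hf) : L2 n) =ᵐ[volume]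
      fun ξ => (logSymbol n θ ξ : ℂ) * (𝓕 f : L2 n) ξ := by
  rw [logOp, FourierTransform.fourier_fourierInv_eq]
  exact MemLp.coeFn_toLp hf

theorem coeFn_fourier_sub (f g : L2 n) :
    (𝓕 (f - g) : L2 n) =ᵐ[volume] fun ξ => (𝓕 f : L2 n) ξ - (𝓕 g : L2 n) ξ := by
  have h : (𝓕 (f - g) : L2 n) = (𝓕 f : L2 n) - (𝓕 g : L2 n) :=
    (FourierTransform.fourierCLM ℂ (L2 n)).map_sub f g
  rw [h]
  exact Lp.coeFn_sub _ _

theorem coeFn_fourier_add (f g : L2 n) :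
    (𝓕 (f + g) : L2 n) =ᵐ[volume] fun ξ => (𝓕 f : L2 n) ξ + (𝓕 g : L2 n) ξ := by
  have h : (𝓕 (f + g) : L2 n) = (𝓕 f : L2 n) + (𝓕 g : L2 n) :=
    (FourierTransform.fourierCLM ℂ (L2 n)).map_add f g
  rw [h]
  exact Lp.coeFn_add _ _

theorem isMildSolution_waveSol (hθ : 1 / 2 < θ) (u₁ : L2 n) :
    IsMildSolution n θ u₁ (waveSol θ u₁) where
  initial := waveSol_zero u₁
  continuousInH1 := continuousInH1_waveSol u₁
  equation := by
    refine ⟨waveVel θ u₁, continuousOn_waveVel u₁, fun t ht => hasDerivWithinAt_waveSol u₁ ht,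
      waveVel_zero u₁, fun t ht => ⟨waveSol_mem_logOpDomain hθ u₁ ht, ?_⟩⟩
    rw [laplacian_eq_iff, intervalIntegral_waveSol hθ u₁ ht,
      FourierTransform.fourier_fourierInv_eq]
    have hv : (𝓕 (waveVel θ u₁ t) : L2 n) = mulL2 (waveSymbolDeriv θ t) (𝓕 u₁ : L2 n) :=
      FourierTransform.fourier_fourierInv_eq _
    filter_upwards [coeFn_fourier_add (waveVel θ u₁ t - u₁)
        (logOp n θ (waveSol θ u₁ t) (waveSol_mem_logOpDomain hθ u₁ ht)),
      coeFn_fourier_sub (waveVel θ u₁ t) u₁,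
      coeFn_fourier_logOp (waveSol_mem_logOpDomain hθ u₁ ht),
      coeFn_fourier_waveSol (θ := θ) u₁ ht,
      coeFn_mulL2 (measurable_waveSymbolDeriv t) (norm_waveSymbolDeriv_le (θ := θ) ht)
        (𝓕 u₁ : L2 n),
      coeFn_mulL2 (measurable_waveSymbolPrim t) (norm_waveSymbolPrim_le hθ ht le_rfl)
        (𝓕 u₁ : L2 n)] with ξ h1 h2 h3 h4 h5 h6
    rw [h1, h2, h3, h4, h6, hv, h5, logSymbol_eq]
    have h7 : ((freq ξ : ℝ) : ℂ) ^ 2 * waveSymbolPrim θ t ξ =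
        1 - waveSymbolDeriv θ t ξ - (damping θ (freq ξ) : ℂ) * waveSymbol θ t ξ := by
      have := sq_mul_oscPrim hθ (freq ξ) t
      unfold waveSymbolPrim waveSymbolDeriv waveSymbol
      exact_mod_cast this
    change _ = -((freq ξ : ℝ) : ℂ) ^ 2 * _
    linear_combination (𝓕 u₁ : L2 n) ξ * h7

end Existence

/-! ### Uniqueness of the mild solution -/

section Uniqueness

variable {n : ℕ} {θ : ℝ}

/-- The symbol `φ(|η|) 1_{|η| ≤ R}`. -/
def cutoff (φ : ℝ → ℝ) (R : ℝ) (ξ : Rn n) : ℂ :=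
  {ξ : Rn n | freq ξ ≤ R}.indicator (fun ξ => (φ (freq ξ) : ℂ)) ξ

theorem measurable_cutoff {φ : ℝ → ℝ} (hφ : Measurable φ) (R : ℝ) :
    Measurable (cutoff (n := n) φ R) :=
  (Complex.measurable_ofReal.comp (hφ.comp measurable_freq)).indicator
    (measurableSet_le measurable_freq measurable_const)

theorem norm_cutoff_le {φ : ℝ → ℝ} {R K : ℝ} (hK : 0 ≤ K)
    (h : ∀ r, 0 ≤ r → r ≤ R → |φ r| ≤ K) (ξ : Rn n) : ‖cutoff φ R ξ‖ ≤ K := by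
  unfold cutoff
  by_cases hξ : freq ξ ≤ R
  · rw [indicator_of_mem (show ξ ∈ {ξ : Rn n | freq ξ ≤ R} from hξ), Complex.norm_real]
    exact h _ (freq_nonneg ξ) hξ
  · rw [indicator_of_notMem (show ξ ∉ {ξ : Rn n | freq ξ ≤ R} from hξ), norm_zero]
    exact hK

/-- The frequency cutoff `𝓕 f ↦ 1_{|η| ≤ R} 𝓕 f` as a bounded operator on `L²`. -/
def cutoffCLM (n : ℕ) (R : ℝ) : L2 n →L[ℂ] L2 n :=
  mulL2CLM (cutoff (fun _ => 1) R) (measurable_cutoff measurable_const R)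
    (norm_cutoff_le (K := 1) zero_le_one fun _ _ _ => by simp)

/-- Multiplication by `log (1 + |η|^{2θ}) 1_{|η| ≤ R}`. -/
def dampingCLM (n : ℕ) {θ : ℝ} (hθ : 1 / 2 < θ) (R : ℝ) : L2 n →L[ℂ] L2 n :=
  mulL2CLM (cutoff (damping θ) R) (measurable_cutoff (measurable_damping θ) R)
    (norm_cutoff_le (K := (1 + 2 * θ) * |R|) (by have : 0 < θ := by linarith
                                                 positivity) fun r hr hrR => by
      rw [abs_of_nonneg (damping_nonneg hr)]
      exact (damping_le hθ hr).trans
        (mul_le_mul_of_nonneg_left (hrR.trans (le_abs_self R)) (by linarith)))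

/-- Multiplication by `|η|² 1_{|η| ≤ R}`. -/
def stiffnessCLM (n : ℕ) (R : ℝ) : L2 n →L[ℂ] L2 n :=
  mulL2CLM (cutoff (fun r => r ^ 2) R) (measurable_cutoff (by fun_prop) R)
    (norm_cutoff_le (K := R ^ 2) (sq_nonneg R) fun r hr hrR => by
      rw [abs_of_nonneg (sq_nonneg r)]
      exact pow_le_pow_left₀ hr hrR 2)

/-- The generator `(X, w) ↦ (w, -|η|² X - ℓ w)` of the equation truncated to `|η| ≤ R`, acting on
pairs `(∫₀ᵗ u, u)`. -/
def truncatedGenerator (n : ℕ) {θ : ℝ} (hθ : 1 / 2 < θ) (R : ℝ) :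
    L2 n × L2 n →L[ℂ] L2 n × L2 n :=
  (ContinuousLinearMap.snd ℂ (L2 n) (L2 n)).prod
    (-(stiffnessCLM n R ∘L ContinuousLinearMap.fst ℂ (L2 n) (L2 n)) -
      dampingCLM n hθ R ∘L ContinuousLinearMap.snd ℂ (L2 n) (L2 n))

theorem cutoffCLM_ae (R : ℝ) (f : L2 n) :
    cutoffCLM n R f =ᵐ[volume] fun ξ => cutoff (fun _ => 1) R ξ * f ξ :=
  coeFn_mulL2CLM _ _ _ f

theorem dampingCLM_ae (hθ : 1 / 2 < θ) (R : ℝ) (f : L2 n) :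
    dampingCLM n hθ R f =ᵐ[volume] fun ξ => cutoff (damping θ) R ξ * f ξ :=
  coeFn_mulL2CLM _ _ _ f

theorem stiffnessCLM_ae (R : ℝ) (f : L2 n) :
    stiffnessCLM n R f =ᵐ[volume] fun ξ => cutoff (fun r => r ^ 2) R ξ * f ξ :=
  coeFn_mulL2CLM _ _ _ f

/-- The truncated Fourier transform of the state `(∫₀ᵗ w, w(t))`. -/
def truncatedState (R : ℝ) (w : ℝ → L2 n) (t : ℝ) : L2 n × L2 n :=
  (cutoffCLM n R (𝓕 (∫ s in (0 : ℝ)..t, w s : L2 n) : L2 n), cutoffCLM n R (𝓕 (w t) : L2 n))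

theorem hasDerivWithinAt_primitive {w : ℝ → L2 n} (hw : ContinuousOn w (Ici 0)) {t : ℝ}
    (ht : 0 ≤ t) : HasDerivWithinAt (fun t => ∫ s in (0 : ℝ)..t, w s) (w t) (Ici t) t := by
  have hsub : Ioi t ⊆ Ici 0 := fun s hs => ht.trans (le_of_lt hs)
  refine intervalIntegral.integral_hasDerivWithinAt_right (t := Ioi t) ?_ ?_ ?_
  · exact (hw.mono (by rw [uIcc_of_le ht]; exact Icc_subset_Ici_self)).intervalIntegrable
  · exact (hw.mono hsub).stronglyMeasurableAtFilter_nhdsWithin measurableSet_Ioi t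
  · exact (hw t ht).mono hsub

/-- In a mild solution, the truncated state solves a linear differential equation with a bounded
generator. -/
theorem IsMildSolution.hasDerivWithinAt_truncatedState (hθ : 1 / 2 < θ) {u₁ : L2 n}
    {w : ℝ → L2 n} (hw : IsMildSolution n θ u₁ w) (R : ℝ) {t : ℝ} (ht : 0 ≤ t) :
    HasDerivWithinAt (truncatedState R w)
      (truncatedGenerator n hθ R (truncatedState R w t) +
        (0, cutoffCLM n R (𝓕 u₁ : L2 n))) (Ici t) t := by
  obtain ⟨v, -, hv, -, heq⟩ := hw.equation
  obtain ⟨hdom, hlap⟩ := heq t ht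
  set P : L2 n →L[ℝ] L2 n :=
    (cutoffCLM n R ∘L FourierTransform.fourierCLM ℂ (L2 n)).restrictScalars ℝ with hP
  have h1 := P.hasFDerivAt.comp_hasDerivWithinAt t
    (hasDerivWithinAt_primitive hw.continuousInH1.1 ht)
  have h2 := P.hasFDerivAt.comp_hasDerivWithinAt t ((hv t ht).mono (Ici_subset_Ici.2 ht))
  have h3 := h1.prodMk h2
  convert! h3 using 1
  set X : L2 n := ∫ s in (0 : ℝ)..t, w s with hX
  refine Prod.ext ?_ ?_
  · simp [truncatedGenerator, truncatedState, hP]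
  · change -(stiffnessCLM n R (cutoffCLM n R (𝓕 X : L2 n))) -
      dampingCLM n hθ R (cutoffCLM n R (𝓕 (w t) : L2 n)) + cutoffCLM n R (𝓕 u₁ : L2 n) =
        cutoffCLM n R (𝓕 (v t) : L2 n)
    rw [laplacian_eq_iff] at hlap
    refine Lp.ext ?_
    set a := stiffnessCLM n R (cutoffCLM n R (𝓕 X : L2 n))
    set b := dampingCLM n hθ R (cutoffCLM n R (𝓕 (w t) : L2 n))
    set c := cutoffCLM n R (𝓕 u₁ : L2 n)
    filter_upwards [hlap, Lp.coeFn_add (-a - b) c, Lp.coeFn_sub (-a) b, Lp.coeFn_neg a,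
      stiffnessCLM_ae R (cutoffCLM n R (𝓕 X : L2 n)), cutoffCLM_ae R (𝓕 X : L2 n),
      dampingCLM_ae hθ R (cutoffCLM n R (𝓕 (w t) : L2 n)), cutoffCLM_ae R (𝓕 (w t) : L2 n),
      cutoffCLM_ae R (𝓕 u₁ : L2 n), cutoffCLM_ae R (𝓕 (v t) : L2 n),
      coeFn_fourier_add (v t - u₁) (logOp n θ (w t) hdom), coeFn_fourier_sub (v t) u₁,
      coeFn_fourier_logOp hdom] with ξ e1 e2 e3 e4 e5 e6 e7 e8 e9 e10 e11 e12 e13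
    rw [e2, Pi.add_apply, e3, Pi.sub_apply, e4, Pi.neg_apply, e5, e6, e7, e8, e9, e10]
    rw [e11, e12, e13, logSymbol_eq] at e1
    change _ = -((freq ξ : ℝ) : ℂ) ^ 2 * _ at e1
    unfold cutoff
    by_cases hξ : freq ξ ≤ R
    · simp only [indicator_of_mem (show ξ ∈ {ξ : Rn n | freq ξ ≤ R} from hξ)]
      push_cast
      linear_combination -e1
    · simp only [indicator_of_notMem (show ξ ∉ {ξ : Rn n | freq ξ ≤ R} from hξ)]
      ring

theorem IsMildSolution.continuousOn_truncatedState {u₁ : L2 n} {w : ℝ → L2 n}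
    (hw : IsMildSolution n θ u₁ w) (R : ℝ) {T : ℝ} (hT : 0 ≤ T) :
    ContinuousOn (truncatedState R w) (Icc 0 T) := by
  have hc := hw.continuousInH1.1.mono (Icc_subset_Ici_self : Icc 0 T ⊆ Ici 0)
  have h1 : ContinuousOn (fun t => ∫ s in (0 : ℝ)..t, w s) (Icc 0 T) := by
    have h := intervalIntegral.continuousOn_primitive_interval (μ := volume) (f := w) (a := 0)
      (b := T) (by rw [uIcc_of_le hT]; exact hc.integrableOn_Icc)
    rwa [uIcc_of_le hT] at h
  have hP := (cutoffCLM n R ∘L FourierTransform.fourierCLM ℂ (L2 n)).continuous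
  exact (hP.comp_continuousOn h1).prodMk (hP.comp_continuousOn hc)

theorem eq_of_cutoffCLM_eq {f g : L2 n} (h : ∀ N : ℕ, cutoffCLM n N f = cutoffCLM n N g) :
    f = g := by
  refine Lp.ext ?_
  have h1 : ∀ᵐ ξ, ∀ N : ℕ, cutoff (fun _ => 1) N ξ * f ξ = cutoff (fun _ => 1) N ξ * g ξ := by
    rw [ae_all_iff]
    intro N
    have hg := cutoffCLM_ae N g
    rw [← h N] at hg
    exact (cutoffCLM_ae N f).symm.trans hg
  filter_upwards [h1] with ξ hξ
  obtain ⟨N, hN⟩ := exists_nat_ge (freq ξ)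
  have h2 := hξ N
  unfold cutoff at h2
  simpa only [indicator_of_mem (show ξ ∈ {ξ : Rn n | freq ξ ≤ (N : ℝ)} from hN),
    Complex.ofReal_one, one_mul] using h2

theorem IsMildSolution.unique (hθ : 1 / 2 < θ) {u₁ : L2 n} {w u : ℝ → L2 n}
    (hw : IsMildSolution n θ u₁ w) (hu : IsMildSolution n θ u₁ u) {t : ℝ} (ht : 0 ≤ t) :
    w t = u t := by
  have key : (𝓕 (w t) : L2 n) = 𝓕 (u t) := by
    refine eq_of_cutoffCLM_eq fun N => ?_
    have h := ODE_solution_unique (a := 0) (b := t) (K := ‖truncatedGenerator n hθ N‖₊)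
      (v := fun _ y => truncatedGenerator n hθ N y + (0, cutoffCLM n N (𝓕 u₁ : L2 n)))
      (fun _ => by
        simpa using (truncatedGenerator n hθ N).lipschitz.add
          (LipschitzWith.const (0, cutoffCLM n N (𝓕 u₁ : L2 n))))
      (hw.continuousOn_truncatedState N ht)
      (fun s hs => hw.hasDerivWithinAt_truncatedState hθ N hs.1)
      (hu.continuousOn_truncatedState N ht)
      (fun s hs => hu.hasDerivWithinAt_truncatedState hθ N hs.1)
      (by simp [truncatedState, hw.initial, hu.initial])
    exact congrArg Prod.snd (h ⟨ht, le_rfl⟩)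
  have h := congrArg (fun f : L2 n => (𝓕⁻ f : L2 n)) key
  simpa only [FourierTransform.fourierInv_fourier_eq] using h

end Uniqueness

/-! ### One-dimensional estimates of the low-frequency mass -/

section LowFrequency

variable {θ : ℝ}

/-- The radial density of the low-frequency part of `‖u(t)‖²`. -/
def density (n : ℕ) (θ t r : ℝ) : ℝ := r ^ (n - 1) * osc (damping θ r) r t ^ 2

theorem density_nonneg (n : ℕ) (t : ℝ) {r : ℝ} (hr : 0 ≤ r) : 0 ≤ density n θ t r := by
  unfold density
  positivity

theorem integrableOn_density (n : ℕ) {t : ℝ} (ht : 0 ≤ t) (b : ℝ) :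
    IntegrableOn (density n θ t) (Icc 0 b) := by
  have hm : Measurable (density n θ t) :=
    (measurable_id.pow_const _).mul ((measurable_osc_damping θ t).pow_const 2)
  refine Measure.integrableOn_of_bounded (M := b ^ (n - 1) * t ^ 2) measure_Icc_lt_top.ne
    hm.aestronglyMeasurable ?_
  refine (ae_restrict_mem measurableSet_Icc).mono fun r hr => ?_
  rw [Real.norm_of_nonneg (density_nonneg n t hr.1), density]
  have h1 := abs_osc_le (damping_nonneg (θ := θ) hr.1) r ht
  have h2 : osc (damping θ r) r t ^ 2 ≤ t ^ 2 := sq_le_sq' (abs_le.1 h1).1 (abs_le.1 h1).2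
  have h3 := pow_le_pow_left₀ hr.1 hr.2 (n - 1)
  have h4 : 0 ≤ b := hr.1.trans hr.2
  gcongr

theorem intervalIntegrable_density (n : ℕ) {t : ℝ} (ht : 0 ≤ t) {a b : ℝ} (ha : 0 ≤ a)
    (hab : a ≤ b) : IntervalIntegrable (density n θ t) volume a b := by
  rw [intervalIntegrable_iff_integrableOn_Icc_of_le hab]
  exact (integrableOn_density n ht b).mono_set (Icc_subset_Icc_left ha)

theorem integral_density_mono (n : ℕ) {t : ℝ} (ht : 0 ≤ t) {a b c : ℝ} (ha : 0 ≤ a)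
    (hab : a ≤ b) (hbc : b ≤ c) :
    ∫ r in a..b, density n θ t r ≤ ∫ r in (0 : ℝ)..c, density n θ t r := by
  refine intervalIntegral.integral_mono_interval ha hab hbc ?_
    (intervalIntegrable_density n ht le_rfl (ha.trans (hab.trans hbc)))
  refine (ae_restrict_mem measurableSet_Ioc).mono fun r hr => density_nonneg n t hr.1.le

theorem rate_one (θ t : ℝ) : rate 1 θ t = √t := by simp [rate]

theorem rate_two (θ t : ℝ) : rate 2 θ t = √(Real.log t) := by simp [rate]

theorem rate_of_three_le {n : ℕ} (hn : 3 ≤ n) (θ t : ℝ) :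
    rate n θ t = t ^ (-((n : ℝ) - 2) / (4 * θ)) := by
  rw [rate, if_neg (by omega), if_neg (by omega)]

theorem rate_sq_of_three_le {n : ℕ} (hn : 3 ≤ n) (hθ : 1 / 2 < θ) {t : ℝ} (ht : 0 ≤ t) :
    rate n θ t ^ 2 = t ^ (-((n : ℝ) - 2) / (2 * θ)) := by
  rw [rate_of_three_le hn, ← Real.rpow_natCast, ← Real.rpow_mul ht]
  congr 1
  field_simp
  push_cast
  ring

theorem rate_nonneg (n : ℕ) (θ : ℝ) {t : ℝ} (ht : 0 ≤ t) : 0 ≤ rate n θ t := by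
  unfold rate
  split_ifs
  · exact Real.sqrt_nonneg _
  · exact Real.sqrt_nonneg _
  · exact Real.rpow_nonneg ht _

theorem integral_density_le_of_one {t : ℝ} (ht : 0 ≤ t) :
    ∫ r in (0 : ℝ)..1, density 1 θ t r ≤ 4 * t := by
  have hd : ∀ r ∈ uIcc (0 : ℝ) 1, HasDerivAt (fun r => 2 * t * Real.arctan (t * r))
      (2 * t ^ 2 / (1 + t ^ 2 * r ^ 2)) r := fun r _ => by
    have h := (((hasDerivAt_id r).const_mul t).arctan).const_mul (2 * t)
    convert! h using 1
    simp only [id]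
    have : 1 + (t * r) ^ 2 ≠ 0 := by positivity
    rw [← mul_pow]
    field_simp
  have hc : Continuous fun r : ℝ => 2 * t ^ 2 / (1 + t ^ 2 * r ^ 2) :=
    continuous_const.div (by fun_prop) fun r => by positivity
  calc _ ≤ ∫ r in (0 : ℝ)..1, 2 * t ^ 2 / (1 + t ^ 2 * r ^ 2) := by
        refine intervalIntegral.integral_mono_on zero_le_one
          (intervalIntegrable_density 1 ht le_rfl zero_le_one) (hc.intervalIntegrable _ _)
          fun r hr => ?_
        simpa [density] using osc_sq_le (damping_nonneg (θ := θ) hr.1) r ht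
    _ = 2 * t * Real.arctan (t * 1) - 2 * t * Real.arctan (t * 0) :=
        intervalIntegral.integral_eq_sub_of_hasDerivAt hd (hc.intervalIntegrable _ _)
    _ ≤ 4 * t := by
        have h1 := Real.arctan_lt_pi_div_two (t * 1)
        have h2 := Real.pi_le_four
        simp only [mul_zero, Real.arctan_zero, sub_zero]
        nlinarith

theorem integral_density_le_of_two {t : ℝ} (ht : 2 ≤ t) :
    ∫ r in (0 : ℝ)..1, density 2 θ t r ≤ 3 * Real.log t := by
  have hd : ∀ r ∈ uIcc (0 : ℝ) 1, HasDerivAt (fun r => Real.log (1 + t ^ 2 * r ^ 2))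
      (r * (2 * t ^ 2 / (1 + t ^ 2 * r ^ 2))) r := fun r _ => by
    have h0 : 1 + t ^ 2 * r ^ 2 ≠ 0 := by positivity
    have h := ((((hasDerivAt_id r).pow 2).const_mul (t ^ 2)).const_add 1).log h0
    convert! h using 1
    simp only [Pi.pow_apply, id, Nat.cast_ofNat, Nat.add_one_sub_one, pow_one]
    field_simp
  have hc : Continuous fun r : ℝ => r * (2 * t ^ 2 / (1 + t ^ 2 * r ^ 2)) :=
    continuous_id.mul (continuous_const.div (by fun_prop) fun r => by positivity)
  calc _ ≤ ∫ r in (0 : ℝ)..1, r * (2 * t ^ 2 / (1 + t ^ 2 * r ^ 2)) := by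
        refine intervalIntegral.integral_mono_on zero_le_one
          (intervalIntegrable_density 2 (by linarith) le_rfl zero_le_one)
          (hc.intervalIntegrable _ _) fun r hr => ?_
        simpa [density] using mul_le_mul_of_nonneg_left
          (osc_sq_le (damping_nonneg (θ := θ) hr.1) r (by linarith : 0 ≤ t)) hr.1
    _ = Real.log (1 + t ^ 2 * 1 ^ 2) - Real.log (1 + t ^ 2 * 0 ^ 2) :=
        intervalIntegral.integral_eq_sub_of_hasDerivAt hd (hc.intervalIntegrable _ _)
    _ ≤ Real.log (t ^ 3) := by
        simp only [one_pow, mul_one, ne_eq, OfNat.ofNat_ne_zero, not_false_eq_true, zero_pow,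
          mul_zero, add_zero, Real.log_one, sub_zero]
        refine Real.log_le_log (by positivity) ?_
        nlinarith [pow_nonneg (by linarith : (0 : ℝ) ≤ t) 2]
    _ = 3 * Real.log t := by rw [Real.log_pow]; norm_num

theorem integral_density_le_of_three_le {n : ℕ} (hn : 3 ≤ n) (hθ : 1 / 2 < θ) {t : ℝ}
    (ht : 0 < t) :
    ∫ r in (0 : ℝ)..1, density n θ t r ≤
      2 * ((1 / 2) ^ (-((n : ℝ) - 2) / (2 * θ)) * (1 / (2 * θ)) *
        Real.Gamma (((n : ℝ) - 2) / (2 * θ))) * t ^ (-((n : ℝ) - 2) / (2 * θ)) := by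
  have hn' : (3 : ℝ) ≤ n := by exact_mod_cast hn
  have hs : (-1 : ℝ) < (n : ℝ) - 3 := by linarith
  have hi := integrableOn_rpow_mul_exp_neg_mul_rpow hs (by linarith : 0 < 2 * θ)
    (by linarith : 0 < t / 2)
  have h1 := integral_rpow_mul_exp_neg_mul_rpow (by linarith : 0 < 2 * θ) hs
    (by linarith : 0 < t / 2)
  have h2 : t / 2 = 1 / 2 * t := by ring
  rw [show (n : ℝ) - 3 + 1 = n - 2 by ring] at h1
  calc ∫ r in (0 : ℝ)..1, density n θ t r
      = ∫ r in Ioc (0 : ℝ) 1, density n θ t r := intervalIntegral.integral_of_le zero_le_one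
    _ ≤ ∫ r in Ioc (0 : ℝ) 1,
          2 * (r ^ ((n : ℝ) - 3) * Real.exp (-(t / 2) * r ^ (2 * θ))) := by
        refine setIntegral_mono_on
          ((integrableOn_density n ht.le 1).mono_set Ioc_subset_Icc_self)
          ((hi.mono_set Ioc_subset_Ioi_self).const_mul 2) measurableSet_Ioc fun r hr => ?_
        have h3 := osc_sq_le_lowFrequency hθ hr.1 hr.2 ht.le
        have h4 : r ^ ((n : ℝ) - 3) = r ^ (n - 1) * r ^ (-2 : ℝ) := by
          rw [← Real.rpow_natCast r (n - 1), ← Real.rpow_add hr.1, Nat.cast_sub (by omega)]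
          congr 1
          push_cast
          ring
        calc density n θ t r ≤ r ^ (n - 1) *
              (2 * r ^ (-2 : ℝ) * Real.exp (-(t / 2) * r ^ (2 * θ))) :=
            mul_le_mul_of_nonneg_left h3 (pow_nonneg hr.1.le _)
          _ = _ := by rw [h4]; ring
    _ ≤ ∫ r in Ioi (0 : ℝ), 2 * (r ^ ((n : ℝ) - 3) * Real.exp (-(t / 2) * r ^ (2 * θ))) := by
        refine setIntegral_mono_set (hi.const_mul 2) ?_ Ioc_subset_Ioi_self.eventuallyLE
        refine (ae_restrict_mem measurableSet_Ioi).mono fun r hr => ?_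
        have := Real.rpow_nonneg (le_of_lt hr) ((n : ℝ) - 3)
        simp only [Pi.zero_apply]
        positivity
    _ = _ := by
        rw [integral_const_mul, h1, h2, Real.mul_rpow (by norm_num) ht.le]
        ring

/-- The low-frequency mass is bounded above by the square of the rate. -/
theorem exists_integral_density_le {n : ℕ} (hn : 1 ≤ n) (hθ : 1 / 2 < θ) :
    ∃ K : ℝ, 0 < K ∧ ∀ t, 2 ≤ t →
      ∫ r in (0 : ℝ)..1, density n θ t r ≤ K * rate n θ t ^ 2 := by
  rcases (by omega : n = 1 ∨ n = 2 ∨ 3 ≤ n) with rfl | rfl | h3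
  · refine ⟨4, by norm_num, fun t ht => ?_⟩
    rw [rate_one, Real.sq_sqrt (by linarith)]
    exact integral_density_le_of_one (by linarith)
  · refine ⟨3, by norm_num, fun t ht => ?_⟩
    rw [rate_two, Real.sq_sqrt (Real.log_nonneg (by linarith))]
    exact integral_density_le_of_two ht
  · have hn' : (3 : ℝ) ≤ n := by exact_mod_cast h3
    have h0 : 0 < ((n : ℝ) - 2) / (2 * θ) := div_pos (by linarith) (by linarith)
    have h1 := Real.Gamma_pos_of_pos h0
    have h2 : 0 < 2 * θ := by linarith
    refine ⟨2 * ((1 / 2) ^ (-((n : ℝ) - 2) / (2 * θ)) * (1 / (2 * θ)) *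
      Real.Gamma (((n : ℝ) - 2) / (2 * θ))), by positivity, fun t ht => ?_⟩
    rw [rate_sq_of_three_le h3 hθ (by linarith)]
    exact integral_density_le_of_three_le h3 hθ (by linarith)

/-- An exponentially decaying profile is eventually below the rate. -/
theorem eventually_mul_exp_le_rate {n : ℕ} (hn : 1 ≤ n) (θ : ℝ) {c : ℝ} (hc : 0 < c) :
    ∀ᶠ t in atTop, t * Real.exp (-c * t) ≤ rate n θ t := by
  rcases (by omega : n = 1 ∨ n = 2 ∨ 3 ≤ n) with rfl | rfl | h3
  · have h1 := (tendsto_rpow_mul_exp_neg_mul_atTop_nhds_zero 1 c hc).eventually_le_const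
      zero_lt_one
    filter_upwards [h1, eventually_ge_atTop 1] with t h1 ht
    rw [rate_one]
    rw [Real.rpow_one] at h1
    exact h1.trans (Real.one_le_sqrt.2 ht)
  · have h1 := (tendsto_rpow_mul_exp_neg_mul_atTop_nhds_zero 1 c hc).eventually_le_const
      zero_lt_one
    filter_upwards [h1, Real.tendsto_log_atTop.eventually_ge_atTop 1] with t h1 ht
    rw [rate_two]
    rw [Real.rpow_one] at h1
    exact h1.trans (Real.one_le_sqrt.2 ht)
  · have h1 := (tendsto_rpow_mul_exp_neg_mul_atTop_nhds_zero
      (1 - -((n : ℝ) - 2) / (4 * θ)) c hc).eventually_le_const zero_lt_one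
    filter_upwards [h1, eventually_gt_atTop 0] with t h1 ht
    rw [rate_of_three_le h3]
    rw [Real.rpow_sub ht, Real.rpow_one, div_mul_eq_mul_div,
      div_le_one (Real.rpow_pos_of_pos ht _)] at h1
    exact h1

/-- An approximate primitive of `sin² (r t) / r`: the error term in the derivative has a sign, so
that this function bounds the oscillatory integral from below. -/
theorem hasDerivAt_log_sub_sin_div {t r : ℝ} (ht : 0 < t) (hr : 0 < r) :
    HasDerivAt (fun r => Real.log r / 2 - Real.sin (2 * r * t) / (4 * t * r) + 1 / (4 * t * r))
      (Real.sin (r * t) ^ 2 / r - (1 - Real.sin (2 * r * t)) / (4 * t * r ^ 2)) r := by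
  have h1 := (Real.hasDerivAt_log hr.ne').div_const 2
  have h2 : HasDerivAt (fun r => 4 * t * r) (4 * t) r := by
    simpa using (hasDerivAt_id r).const_mul (4 * t)
  have h3 : HasDerivAt (fun r => Real.sin (2 * r * t)) (Real.cos (2 * r * t) * (2 * t)) r := by
    have h := (((hasDerivAt_id r).const_mul 2).mul_const t).sin
    simpa using! h
  have h0 : 4 * t * r ≠ 0 := by positivity
  have h4 := (h1.sub (h3.div h2 h0)).add ((hasDerivAt_const r (1 : ℝ)).div h2 h0)
  convert! h4 using 1
  have h5 : Real.cos (2 * r * t) = 1 - 2 * Real.sin (r * t) ^ 2 := by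
    rw [mul_assoc, Real.cos_two_mul, Real.cos_sq']
    ring
  rw [h5]
  field_simp
  ring

/-- A lower bound for the mass in `a ≤ r ≤ b`. The logarithm is the integral of the mean value
`1/2` of `sin²` against `dr / r`, the second term is due to the oscillation, and the last one to
the difference between the phase and `r t`. -/
theorem integral_density_ge {n : ℕ} (hn : 2 ≤ n) (hθ : 1 / 2 < θ) {t a b : ℝ} (ht : 0 < t)
    (ha : 0 < a) (hab : a ≤ b) (hb : b ≤ 1) (hbt : b ^ (2 * θ) * t ≤ 1) :
    Real.exp (-1) * a ^ (n - 2) *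
        (Real.log (b / a) / 2 - 1 / (2 * t * a) - t * b ^ (4 * θ - 1) / 2) ≤
      ∫ r in a..b, density n θ t r := by
  have hb0 : 0 < b := ha.trans_le hab
  set H : ℝ → ℝ := fun r => Real.log r / 2 - Real.sin (2 * r * t) / (4 * t * r) +
    1 / (4 * t * r) - t / 2 * (r ^ (4 * θ - 1) / (4 * θ - 1)) with hH
  set H' : ℝ → ℝ := fun r => Real.sin (r * t) ^ 2 / r -
    (1 - Real.sin (2 * r * t)) / (4 * t * r ^ 2) - t / 2 * r ^ (4 * θ - 2) with hH'
  have hd : ∀ r, 0 < r → HasDerivAt H (H' r) r := fun r hr => by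
    have h1 := ((Real.hasDerivAt_rpow_const (x := r) (p := 4 * θ - 1)
      (Or.inl hr.ne')).div_const (4 * θ - 1)).const_mul (t / 2)
    have h2 := (hasDerivAt_log_sub_sin_div ht hr).sub h1
    convert! h2 using 1
    rw [hH', show 4 * θ - 1 - 1 = 4 * θ - 2 by ring, mul_div_cancel_left₀ _ (by linarith)]
  have hle : ∀ r ∈ Ioo a b, Real.exp (-1) * a ^ (n - 2) * H' r ≤ density n θ t r := by
    intro r hr
    have hr0 : 0 < r := ha.trans hr.1
    have hrt : r ^ (2 * θ) * t ≤ 1 := le_trans (by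
      have := Real.rpow_le_rpow hr0.le hr.2.le (by linarith : 0 ≤ 2 * θ)
      gcongr) hbt
    have h1 := osc_sq_ge hθ hr0 (hr.2.le.trans hb) ht.le hrt
    have h2 : H' r ≤ (Real.sin (r * t) ^ 2 - t * r ^ (4 * θ - 1) / 2) / r := by
      have h3 : r ^ (4 * θ - 2) = r ^ (4 * θ - 1) / r := by
        rw [← Real.rpow_sub_one hr0.ne']
        congr 1
        ring
      have h4 : 0 ≤ (1 - Real.sin (2 * r * t)) / (4 * t * r ^ 2) :=
        div_nonneg (by linarith [Real.sin_le_one (2 * r * t)]) (by positivity)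
      have h5 : (Real.sin (r * t) ^ 2 - t * r ^ (4 * θ - 1) / 2) / r =
          Real.sin (r * t) ^ 2 / r - t / 2 * (r ^ (4 * θ - 1) / r) := by ring
      rw [h5, hH']
      simp only [h3]
      linarith
    have h6 : density n θ t r = r ^ (n - 2) * (r ^ 2 * osc (damping θ r) r t ^ 2 / r) := by
      rw [density, show n - 1 = n - 2 + 1 by omega, pow_succ]
      field_simp
    calc Real.exp (-1) * a ^ (n - 2) * H' r
        ≤ Real.exp (-1) * a ^ (n - 2) *
            ((Real.sin (r * t) ^ 2 - t * r ^ (4 * θ - 1) / 2) / r) := by gcongr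
      _ = a ^ (n - 2) *
            (Real.exp (-1) * (Real.sin (r * t) ^ 2 - t * r ^ (4 * θ - 1) / 2) / r) := by ring
      _ ≤ a ^ (n - 2) * (r ^ 2 * osc (damping θ r) r t ^ 2 / r) := by gcongr
      _ ≤ r ^ (n - 2) * (r ^ 2 * osc (damping θ r) r t ^ 2 / r) := by
          have := hr.1.le
          gcongr
      _ = _ := h6.symm
  have hint := intervalIntegral.sub_le_integral_of_hasDeriv_right_of_le hab
    (g := fun r => Real.exp (-1) * a ^ (n - 2) * H r)
    (g' := fun r => Real.exp (-1) * a ^ (n - 2) * H' r)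
    (fun r hr => ((hd r (ha.trans_le hr.1)).const_mul _).continuousAt.continuousWithinAt)
    (fun r hr => ((hd r (ha.trans hr.1)).const_mul _).hasDerivWithinAt)
    ((integrableOn_density n ht.le b).mono_set (Icc_subset_Icc_left ha.le)) hle
  refine le_trans ?_ hint
  rw [← mul_sub]
  refine mul_le_mul_of_nonneg_left ?_ (by positivity)
  have e1 : 0 ≤ (1 - Real.sin (2 * b * t)) / (4 * t * b) :=
    div_nonneg (by linarith [Real.sin_le_one (2 * b * t)]) (by positivity)
  have e2 : 0 ≤ (1 + Real.sin (2 * a * t)) / (4 * t * a) :=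
    div_nonneg (by linarith [Real.neg_one_le_sin (2 * a * t)]) (by positivity)
  have e3 : 0 ≤ t / 2 * (a ^ (4 * θ - 1) / (4 * θ - 1)) :=
    mul_nonneg (by linarith) (div_nonneg (Real.rpow_nonneg ha.le _) (by linarith))
  have e4 : t / 2 * (b ^ (4 * θ - 1) / (4 * θ - 1)) ≤ t * b ^ (4 * θ - 1) / 2 := by
    have := div_le_self (Real.rpow_nonneg hb0.le (4 * θ - 1)) (by linarith : 1 ≤ 4 * θ - 1)
    nlinarith
  have e5 : 1 / (2 * t * a) = 2 * (1 / (4 * t * a)) := by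
    field_simp
    norm_num
  rw [Real.log_div hb0.ne' ha.ne', e5, hH]
  simp only
  rw [sub_div] at e1
  rw [add_div] at e2
  linarith

theorem integral_density_one_ge (hθ : 1 / 2 < θ) {t : ℝ} (ht : 1 ≤ t) :
    1 / 16 * t ≤ ∫ r in (0 : ℝ)..1 / t, density 1 θ t r := by
  have ht0 : 0 < t := by linarith
  have h1 : (0 : ℝ) ≤ 1 / t := by positivity
  have h2 : 1 / t ≤ 1 := (div_le_one ht0).2 ht
  calc 1 / 16 * t = ∫ _ in (0 : ℝ)..1 / t, (t / 4) ^ 2 := by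
        rw [intervalIntegral.integral_const, smul_eq_mul]
        field_simp
        norm_num
    _ ≤ _ := by
        refine intervalIntegral.integral_mono_on_of_le_Ioo h1 (by simp)
          (intervalIntegrable_density 1 ht0.le le_rfl h1) fun r hr => ?_
        have h3 : r * t ≤ 1 := by
          have := (le_div_iff₀ ht0).1 hr.2.le
          exact this
        have h4 := osc_ge_div_four hθ hr.1 (hr.2.le.trans h2) ht0 h3
        have h5 := pow_le_pow_left₀ (by positivity) h4 2
        simpa [density] using h5

/-- The low-frequency mass is bounded below by the square of the rate. It suffices to look at
`r ≤ t^{-1/(2θ)}`, where the damping factor is of order one. -/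
theorem exists_integral_density_ge {n : ℕ} (hn : 1 ≤ n) (hθ : 1 / 2 < θ) :
    ∃ c : ℝ, 0 < c ∧ ∀ᶠ t in atTop,
      c * rate n θ t ^ 2 ≤ ∫ r in (0 : ℝ)..t ^ (-(1 / (2 * θ))), density n θ t r := by
  have h2θ : 0 < 2 * θ := by linarith
  have hq : 1 / (2 * θ) < 1 := (div_lt_one h2θ).2 (by linarith)
  have hq0 : 0 < 1 / (2 * θ) := by positivity
  set q := 1 / (2 * θ) with hqdef
  have hbb : ∀ t : ℝ, 1 ≤ t → t ^ (-q) ≤ 1 := fun t ht =>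
    Real.rpow_le_one_of_one_le_of_nonpos ht (by linarith)
  have hbt : ∀ t : ℝ, 1 ≤ t → (t ^ (-q)) ^ (2 * θ) * t ≤ 1 := fun t ht => by
    rw [← Real.rpow_mul (by linarith), show -q * (2 * θ) = -1 by rw [hqdef]; field_simp,
      Real.rpow_neg_one, inv_mul_cancel₀ (by linarith)]
  have herr : ∀ t : ℝ, 1 ≤ t → t * (t ^ (-q)) ^ (4 * θ - 1) = t ^ (-(1 - q)) := fun t ht => by
    have h0 : 0 < t := by linarith
    rw [← Real.rpow_mul h0.le, mul_comm, ← Real.rpow_add_one h0.ne']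
    congr 1
    rw [hqdef]
    field_simp
    ring
  -- `hbt`: the damping exponent is at most one for `r ≤ t ^ (-q)`.
  -- `herr`: the cost of replacing the phase by `r t` is `t ^ (-(1 - q))`, and `q < 1` as `θ > 1/2`.
  rcases (by omega : n = 1 ∨ n = 2 ∨ 3 ≤ n) with rfl | rfl | h3
  · refine ⟨1 / 16, by norm_num, ?_⟩
    filter_upwards [eventually_ge_atTop 1] with t ht
    have h0 : 0 < t := by linarith
    rw [rate_one, Real.sq_sqrt h0.le]
    refine (integral_density_one_ge hθ ht).trans
      (integral_density_mono 1 h0.le le_rfl (by positivity) ?_)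
    rw [one_div, ← Real.rpow_neg_one]
    exact Real.rpow_le_rpow_of_exponent_le ht (by linarith)
  · refine ⟨Real.exp (-1) * ((1 - q) / 4), mul_pos (Real.exp_pos _) (by linarith), ?_⟩
    filter_upwards [eventually_ge_atTop 1,
      Real.tendsto_log_atTop.eventually_ge_atTop (4 / (1 - q))] with t ht hlog
    have h0 : 0 < t := by linarith
    have hab : 1 / t ≤ t ^ (-q) := by
      rw [one_div, ← Real.rpow_neg_one]
      exact Real.rpow_le_rpow_of_exponent_le ht (by linarith)
    have h1 := integral_density_ge (n := 2) le_rfl hθ h0 (one_div_pos.2 h0) hab (hbb t ht)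
      (hbt t ht)
    rw [rate_two, Real.sq_sqrt (Real.log_nonneg ht)]
    refine le_trans ?_ (h1.trans (integral_density_mono 2 h0.le (by positivity) hab le_rfl))
    rw [herr t ht, Real.log_div (by positivity) (by positivity), Real.log_rpow h0, one_div,
      Real.log_inv, show 1 / (2 * t * t⁻¹) = 1 / 2 by field_simp, Nat.sub_self, pow_zero, mul_one,
      mul_assoc]
    refine mul_le_mul_of_nonneg_left ?_ (Real.exp_pos _).le
    have h2 : t ^ (-(1 - q)) ≤ 1 := Real.rpow_le_one_of_one_le_of_nonpos ht (by linarith)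
    rw [div_le_iff₀ (by linarith)] at hlog
    nlinarith
  · refine ⟨Real.exp (-1) * ((1 / 2) ^ (n - 2) * (1 / 4)), by positivity, ?_⟩
    have hlim := tendsto_rpow_neg_atTop (by linarith : 0 < 1 - q)
    filter_upwards [eventually_ge_atTop 1, hlim.eventually_le_const (by norm_num :
      (0 : ℝ) < 1 / 20)] with t ht hsmall
    have h0 : 0 < t := by linarith
    have hb0 : 0 < t ^ (-q) := Real.rpow_pos_of_pos h0 _
    have h1 := integral_density_ge (n := n) (by omega) hθ h0 (half_pos hb0)
      (half_le_self hb0.le) (hbb t ht) (hbt t ht)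
    refine le_trans ?_ (h1.trans (integral_density_mono n h0.le (by positivity)
      (half_le_self hb0.le) le_rfl))
    rw [herr t ht, rate_sq_of_three_le h3 hθ h0.le]
    have e1 : t ^ (-q) / (t ^ (-q) / 2) = 2 := by field_simp
    have e2 : 1 / (2 * t * (t ^ (-q) / 2)) = t ^ (-(1 - q)) := by
      rw [show 2 * t * (t ^ (-q) / 2) = t ^ (-q) * t by ring, ← Real.rpow_add_one h0.ne',
        one_div, ← Real.rpow_neg h0.le]
      congr 1
      ring
    have e3 : (t ^ (-q) / 2) ^ (n - 2) =
        (1 / 2) ^ (n - 2) * t ^ (-((n : ℝ) - 2) / (2 * θ)) := by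
      rw [div_eq_mul_one_div, mul_comm, mul_pow, ← Real.rpow_natCast (t ^ (-q)),
        ← Real.rpow_mul h0.le, Nat.cast_sub (by omega)]
      congr 2
      rw [hqdef]
      push_cast
      ring
    rw [e1, e2, e3]
    have e4 : 1 / 4 ≤ Real.log 2 / 2 - t ^ (-(1 - q)) - t ^ (-(1 - q)) / 2 := by
      linarith [Real.log_two_gt_d9]
    have e5 : 0 ≤ t ^ (-((n : ℝ) - 2) / (2 * θ)) := Real.rpow_nonneg h0.le _
    calc _ = Real.exp (-1) * ((1 / 2) ^ (n - 2) * t ^ (-((n : ℝ) - 2) / (2 * θ))) * (1 / 4) := by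
          ring
      _ ≤ _ := by gcongr

end LowFrequency

/-! ### Decay and growth rates of the `L²` norm -/

section Rates

variable {n : ℕ} {θ : ℝ}

/-- The Jacobian constant of polar coordinates in the variable `η = 2πξ`. -/
def polarConst (n : ℕ) : ℝ :=
  n * volume.real (Metric.ball (0 : Rn n) 1) * ((2 * Real.pi) ^ n)⁻¹

theorem polarConst_pos (hn : 1 ≤ n) : 0 < polarConst n := by
  have h1 : 0 < volume.real (Metric.ball (0 : Rn n) 1) :=
    ENNReal.toReal_pos (Metric.measure_ball_pos _ _ one_pos).ne' measure_ball_lt_top.ne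
  have h2 : (0 : ℝ) < n := by exact_mod_cast hn
  unfold polarConst
  positivity

theorem integral_freq (hn : 1 ≤ n) (f : ℝ → ℝ) :
    ∫ ξ : Rn n, f (freq ξ) = polarConst n * ∫ r in Ioi (0 : ℝ), r ^ (n - 1) * f r := by
  have : Nonempty (Fin n) := ⟨⟨0, hn⟩⟩
  have h2π : 0 < 2 * Real.pi := by positivity
  have h1 := integral_fun_norm_addHaar (volume : Measure (Rn n)) fun y => f (2 * Real.pi * y)
  have h2 := integral_comp_mul_left_Ioi (fun r => r ^ (n - 1) * f r) 0 h2π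
  have h3 : ∀ y : ℝ, (2 * Real.pi * y) ^ (n - 1) * f (2 * Real.pi * y) =
      (2 * Real.pi) ^ (n - 1) * (y ^ (n - 1) • f (2 * Real.pi * y)) := fun y => by
    rw [mul_pow, smul_eq_mul, mul_assoc]
  simp only [h3, integral_const_mul, mul_zero, smul_eq_mul] at h2
  have h4 : ∫ y in Ioi (0 : ℝ), y ^ (n - 1) • f (2 * Real.pi * y) =
      ((2 * Real.pi) ^ n)⁻¹ * ∫ r in Ioi (0 : ℝ), r ^ (n - 1) * f r := by
    have h5 : (2 * Real.pi) ^ n = (2 * Real.pi) ^ (n - 1) * (2 * Real.pi) := by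
      rw [← pow_succ, Nat.sub_add_cancel hn]
    rw [h5, mul_inv, mul_assoc, ← h2, ← mul_assoc, inv_mul_cancel₀ (by positivity), one_mul]
    simp only [smul_eq_mul]
  unfold freq polarConst
  rw [h1, finrank_euclideanSpace_fin, h4]
  simp only [nsmul_eq_mul, smul_eq_mul]
  ring

/-- The region `0 < |η| ≤ b` of frequencies. -/
def lowFreq (n : ℕ) (b : ℝ) : Set (Rn n) := {ξ | freq ξ ∈ Ioc 0 b}

theorem measurableSet_lowFreq (b : ℝ) : MeasurableSet (lowFreq n b) :=
  measurable_freq measurableSet_Ioc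

theorem setIntegral_lowFreq (hn : 1 ≤ n) (t : ℝ) {b : ℝ} (hb : 0 ≤ b) :
    ∫ ξ in lowFreq n b, ‖waveSymbol θ t ξ‖ ^ 2 =
      polarConst n * ∫ r in (0 : ℝ)..b, density n θ t r := by
  have h1 := integral_freq hn ((Ioc 0 b).indicator fun r => osc (damping θ r) r t ^ 2)
  have h2 : ∀ r, r ^ (n - 1) * (Ioc 0 b).indicator (fun r => osc (damping θ r) r t ^ 2) r =
      (Ioc 0 b).indicator (density n θ t) r := fun r => by
    by_cases hr : r ∈ Ioc 0 b <;> simp [hr, density]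
  simp only [h2] at h1
  rw [setIntegral_indicator measurableSet_Ioc, inter_eq_right.2 Ioc_subset_Ioi_self] at h1
  rw [intervalIntegral.integral_of_le hb, ← h1, ← integral_indicator (measurableSet_lowFreq b)]
  refine integral_congr_ae (ae_of_all _ fun ξ => ?_)
  by_cases hξ : freq ξ ∈ Ioc 0 b
  · simp only [indicator_of_mem hξ, indicator_of_mem (show ξ ∈ lowFreq n b from hξ), waveSymbol,
      Complex.norm_real, Real.norm_eq_abs, sq_abs]
  · simp only [indicator_of_notMem hξ, indicator_of_notMem (show ξ ∉ lowFreq n b from hξ)]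

theorem norm_waveSol_sq (u₁ : L2 n) {t : ℝ} (ht : 0 ≤ t) :
    ‖waveSol θ u₁ t‖ ^ 2 = ∫ ξ, ‖waveSymbol θ t ξ‖ ^ 2 * ‖(𝓕 u₁ : L2 n) ξ‖ ^ 2 := by
  rw [← Lp.norm_fourier_eq, norm_sq_eq_integral]
  refine integral_congr_ae ?_
  filter_upwards [coeFn_fourier_waveSol (θ := θ) u₁ ht] with ξ hξ
  rw [hξ, norm_mul, mul_pow]

theorem integrable_waveSymbol_sq (u₁ : L2 n) {t : ℝ} (ht : 0 ≤ t) :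
    Integrable fun ξ => ‖waveSymbol θ t ξ‖ ^ 2 * ‖(𝓕 u₁ : L2 n) ξ‖ ^ 2 := by
  refine (integrable_norm_sq (𝓕 (waveSol θ u₁ t) : L2 n)).congr ?_
  filter_upwards [coeFn_fourier_waveSol (θ := θ) u₁ ht] with ξ hξ
  rw [hξ, norm_mul, mul_pow]

theorem integrableOn_lowFreq {t : ℝ} (ht : 0 ≤ t) (b : ℝ) :
    IntegrableOn (fun ξ => ‖waveSymbol θ t ξ‖ ^ 2) (lowFreq n b) := by
  refine Measure.integrableOn_of_bounded (M := t ^ 2) ?_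
    ((measurable_waveSymbol t).norm.pow_const 2).aestronglyMeasurable
    (ae_of_all _ fun ξ => ?_)
  · refine ((measure_mono fun ξ hξ => ?_).trans_lt
      (measure_closedBall_lt_top (x := (0 : Rn n)) (r := b))).ne
    rw [mem_closedBall_zero_iff]
    have h1 : 2 * Real.pi * ‖ξ‖ ≤ b := hξ.2
    nlinarith [norm_nonneg ξ, Real.pi_gt_three]
  · rw [Real.norm_of_nonneg (by positivity)]
    exact pow_le_pow_left₀ (norm_nonneg _) (norm_waveSymbol_le ht ξ) 2

theorem norm_fourierIntegral_le (f : Rn n → ℂ) (ξ : Rn n) : ‖𝓕 f ξ‖ ≤ ∫ x, ‖f x‖ :=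
  VectorFourier.norm_fourierIntegral_le_integral_norm _ _ _ f ξ

theorem integral_norm_le_norm11 {f : Rn n → ℂ} (hf : MemL11 n f) : ∫ x, ‖f x‖ ≤ norm11 n f :=
  integral_mono hf.1.norm hf.2 fun x => by
    nlinarith [norm_nonneg x, norm_nonneg (f x)]

theorem norm11_nonneg (f : Rn n → ℂ) : 0 ≤ norm11 n f :=
  integral_nonneg fun x => by positivity

/-- The upper bound: frequencies `|η| ≤ 1` are estimated by `‖𝓕 u₁‖_∞ ≤ ‖u₁‖_{L¹}`, and the others
by exponential decay. -/
theorem exists_norm_waveSol_le (hn : 1 ≤ n) (hθ : 1 / 2 < θ) :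
    ∃ K : ℝ, 0 < K ∧ ∃ T₀ : ℝ, 1 < T₀ ∧ ∀ u₁ : L2 n, MemL11 n u₁ → ∀ t, T₀ ≤ t →
      ‖waveSol θ u₁ t‖ ≤ K * dataSize n u₁ * rate n θ t := by
  obtain ⟨K, hK, hlow⟩ := exists_integral_density_le hn hθ
  obtain ⟨c, hc, hhigh⟩ := exists_osc_highFrequency_decay hθ
  obtain ⟨T, hT⟩ := eventually_atTop.1 (eventually_mul_exp_le_rate hn θ hc)
  have hκ := polarConst_pos hn
  refine ⟨√(polarConst n * K + 1), Real.sqrt_pos.2 (by positivity), max T 2,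
    lt_max_of_lt_right (by norm_num), fun u₁ hu t ht => ?_⟩
  have htT : T ≤ t := (le_max_left _ _).trans ht
  have ht2 : 2 ≤ t := (le_max_right _ _).trans ht
  have ht0 : 0 ≤ t := by linarith
  have hρ := rate_nonneg n θ ht0
  have hD : 0 ≤ dataSize n u₁ := add_nonneg (norm11_nonneg _) (norm_nonneg _)
  have hD1 : norm11 n u₁ ≤ dataSize n u₁ := le_add_of_nonneg_right (norm_nonneg _)
  have hD2 : ‖u₁‖ ≤ dataSize n u₁ := le_add_of_nonneg_left (norm11_nonneg _)
  have hint := integrable_waveSymbol_sq (θ := θ) u₁ ht0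
  have h1 : ∫ ξ in lowFreq n 1, ‖waveSymbol θ t ξ‖ ^ 2 * ‖(𝓕 u₁ : L2 n) ξ‖ ^ 2 ≤
      polarConst n * K * rate n θ t ^ 2 * dataSize n u₁ ^ 2 := by
    calc _ ≤ ∫ ξ in lowFreq n 1, ‖waveSymbol θ t ξ‖ ^ 2 * dataSize n u₁ ^ 2 := by
          refine integral_mono_ae hint.integrableOn
            ((integrableOn_lowFreq ht0 1).mul_const _) (ae_restrict_of_ae ?_)
          filter_upwards [fourier_ae_eq_fourierIntegral u₁ hu.1] with ξ hξ
          rw [hξ]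
          have := ((norm_fourierIntegral_le (u₁ : Rn n → ℂ) ξ).trans
            (integral_norm_le_norm11 hu)).trans hD1
          gcongr
      _ = polarConst n * (∫ r in (0 : ℝ)..1, density n θ t r) * dataSize n u₁ ^ 2 := by
          rw [integral_mul_const, setIntegral_lowFreq hn t zero_le_one]
      _ ≤ polarConst n * (K * rate n θ t ^ 2) * dataSize n u₁ ^ 2 := by
          have := hlow t ht2
          gcongr
      _ = _ := by ring
  have h2 : ∫ ξ in (lowFreq n 1)ᶜ, ‖waveSymbol θ t ξ‖ ^ 2 * ‖(𝓕 u₁ : L2 n) ξ‖ ^ 2 ≤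
      rate n θ t ^ 2 * dataSize n u₁ ^ 2 := by
    have hnorm := integrable_norm_sq (𝓕 u₁ : L2 n)
    calc _ ≤ ∫ ξ in (lowFreq n 1)ᶜ, rate n θ t ^ 2 * ‖(𝓕 u₁ : L2 n) ξ‖ ^ 2 := by
          refine setIntegral_mono_on_ae hint.integrableOn (hnorm.const_mul _).integrableOn
            (measurableSet_lowFreq 1).compl ?_
          have : Nonempty (Fin n) := ⟨⟨0, hn⟩⟩
          filter_upwards [Measure.ae_ne volume (0 : Rn n)] with ξ hξ0 hξ
          have hpos : 0 < freq ξ := by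
            have := norm_pos_iff.2 hξ0
            unfold freq
            positivity
          -- The null set `{0}` is excluded: there the symbol is `t`, which does not decay.
          have hge : 1 ≤ freq ξ := by
            by_contra hlt
            exact hξ ⟨hpos, (not_le.1 hlt).le⟩
          have h3 : ‖waveSymbol θ t ξ‖ ≤ rate n θ t := by
            rw [waveSymbol, Complex.norm_real]
            exact (hhigh _ t hge ht0).trans (hT t htT)
          gcongr
      _ ≤ ∫ ξ, rate n θ t ^ 2 * ‖(𝓕 u₁ : L2 n) ξ‖ ^ 2 :=
          setIntegral_le_integral (hnorm.const_mul _) (ae_of_all _ fun ξ => by positivity)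
      _ = rate n θ t ^ 2 * ‖u₁‖ ^ 2 := by
          rw [integral_const_mul, ← norm_sq_eq_integral, Lp.norm_fourier_eq]
      _ ≤ _ := by gcongr
  have h3 : ‖waveSol θ u₁ t‖ ^ 2 ≤
      (√(polarConst n * K + 1) * dataSize n u₁ * rate n θ t) ^ 2 := by
    rw [norm_waveSol_sq u₁ ht0, ← integral_add_compl (measurableSet_lowFreq 1) hint, mul_pow,
      mul_pow, Real.sq_sqrt (by positivity)]
    linarith
  exact le_of_sq_le_sq h3 (by positivity)

/-- The lower bound: `|𝓕 u₁| ≥ |P₁| / 2` in a neighbourhood of the origin, and the mass of the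
symbol in a shrinking neighbourhood of the origin is of the order of the squared rate. -/
theorem exists_le_norm_waveSol (hn : 1 ≤ n) (hθ : 1 / 2 < θ) :
    ∃ c : ℝ, 0 < c ∧ ∀ u₁ : L2 n, MemL11 n u₁ →
      ∀ᶠ t in atTop, c * ‖mass n u₁‖ * rate n θ t ≤ ‖waveSol θ u₁ t‖ := by
  obtain ⟨c, hc, hlow⟩ := exists_integral_density_ge hn hθ
  have hκ := polarConst_pos hn
  refine ⟨√(polarConst n * c) / 2, by positivity, fun u₁ hu => ?_⟩
  have hcont : Continuous (𝓕 (u₁ : Rn n → ℂ)) :=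
    VectorFourier.fourierIntegral_continuous Real.continuous_fourierChar (L := innerₗ (Rn n))
      continuous_inner hu.1
  have hzero : 𝓕 (u₁ : Rn n → ℂ) 0 = mass n u₁ := by
    rw [Real.fourier_eq]
    simp [mass]
  by_cases hP : mass n u₁ = 0
  · exact Eventually.of_forall fun t => by simp [hP]
  have hP0 : 0 < ‖mass n u₁‖ := norm_pos_iff.2 hP
  have hnear : ∀ᶠ ξ in 𝓝 (0 : Rn n), ‖mass n u₁‖ / 2 < ‖𝓕 (u₁ : Rn n → ℂ) ξ‖ := by
    refine (hcont.norm.tendsto 0).eventually_const_lt ?_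
    rw [hzero]
    linarith
  obtain ⟨δ, hδ, hball⟩ := Metric.eventually_nhds_iff.1 hnear
  have hlim : Tendsto (fun t : ℝ => t ^ (-(1 / (2 * θ)))) atTop (𝓝 0) :=
    tendsto_rpow_neg_atTop (by positivity)
  filter_upwards [hlow, hlim.eventually_lt_const hδ, eventually_ge_atTop 1] with t hlow hb ht
  have ht0 : 0 ≤ t := by linarith
  set b := t ^ (-(1 / (2 * θ)))
  have hb0 : 0 ≤ b := Real.rpow_nonneg ht0 _
  have hint := integrable_waveSymbol_sq (θ := θ) u₁ ht0
  have h1 : (√(polarConst n * c) / 2 * ‖mass n u₁‖ * rate n θ t) ^ 2 ≤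
      ‖waveSol θ u₁ t‖ ^ 2 := by
    calc (√(polarConst n * c) / 2 * ‖mass n u₁‖ * rate n θ t) ^ 2
        = polarConst n * (c * rate n θ t ^ 2) * (‖mass n u₁‖ / 2) ^ 2 := by
          rw [mul_pow, mul_pow, div_pow, Real.sq_sqrt (by positivity)]
          ring
      _ ≤ polarConst n * (∫ r in (0 : ℝ)..b, density n θ t r) * (‖mass n u₁‖ / 2) ^ 2 := by
          gcongr
      _ = ∫ ξ in lowFreq n b, ‖waveSymbol θ t ξ‖ ^ 2 * (‖mass n u₁‖ / 2) ^ 2 := by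
          rw [integral_mul_const, setIntegral_lowFreq hn t hb0]
      _ ≤ ∫ ξ in lowFreq n b, ‖waveSymbol θ t ξ‖ ^ 2 * ‖(𝓕 u₁ : L2 n) ξ‖ ^ 2 := by
          refine setIntegral_mono_on_ae ((integrableOn_lowFreq ht0 b).mul_const _)
            hint.integrableOn (measurableSet_lowFreq b) ?_
          filter_upwards [fourier_ae_eq_fourierIntegral u₁ hu.1] with ξ hξ hmem
          rw [hξ]
          have h2 : 2 * Real.pi * ‖ξ‖ ≤ b := hmem.2
          have h3 : dist ξ 0 < δ := by
            rw [dist_zero_right]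
            nlinarith [norm_nonneg ξ, Real.pi_gt_three]
          have h4 := (hball h3).le
          gcongr
      _ ≤ ∫ ξ, ‖waveSymbol θ t ξ‖ ^ 2 * ‖(𝓕 u₁ : L2 n) ξ‖ ^ 2 :=
          setIntegral_le_integral hint (ae_of_all _ fun ξ => by positivity)
      _ = _ := (norm_waveSol_sq u₁ ht0).symm
  exact le_of_sq_le_sq h1 (norm_nonneg _)

end Rates

end LogDampedWave

end

theorem theorem1p2 (n : ℕ) (hn : 1 ≤ n) (θ : ℝ) (hθ : 1 / 2 < θ) :
    ∃ C : ℝ, 0 < C ∧ ∃ T₀ : ℝ, 1 < T₀ ∧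
      ∀ u₁ : LogDampedWave.L2 n, LogDampedWave.MemL11 n u₁ →
        ∃ u : ℝ → LogDampedWave.L2 n,
          LogDampedWave.IsMildSolution n θ u₁ u ∧
          (∀ w : ℝ → LogDampedWave.L2 n, LogDampedWave.IsMildSolution n θ u₁ w →
            ∀ t, 0 ≤ t → w t = u t) ∧
          (∀ t, T₀ ≤ t →
            ‖u t‖ ≤ C⁻¹ * LogDampedWave.dataSize n u₁ * LogDampedWave.rate n θ t) ∧
          ∃ T₁ : ℝ, T₀ ≤ T₁ ∧ ∀ t, T₁ ≤ t →
            C * ‖LogDampedWave.mass n u₁‖ * LogDampedWave.rate n θ t ≤ ‖u t‖ := by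
  obtain ⟨K, hK, T₀, hT₀, hupper⟩ := LogDampedWave.exists_norm_waveSol_le hn hθ
  obtain ⟨c, hc, hlower⟩ := LogDampedWave.exists_le_norm_waveSol hn hθ
  refine ⟨min K⁻¹ c, lt_min (inv_pos.2 hK) hc, T₀, hT₀, fun u₁ hu =>
    ⟨LogDampedWave.waveSol θ u₁, LogDampedWave.isMildSolution_waveSol hθ u₁,
      fun w hw t ht => hw.unique hθ (LogDampedWave.isMildSolution_waveSol hθ u₁) ht,
      fun t ht => ?_, ?_⟩⟩
  · have h1 : K ≤ (min K⁻¹ c)⁻¹ := by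
      rw [le_inv_comm₀ hK (lt_min (inv_pos.2 hK) hc)]
      exact min_le_left _ _
    have h2 := LogDampedWave.rate_nonneg n θ (by linarith : 0 ≤ t)
    have h3 : 0 ≤ LogDampedWave.dataSize n u₁ :=
      add_nonneg (LogDampedWave.norm11_nonneg _) (norm_nonneg _)
    refine (hupper u₁ hu t ht).trans ?_
    gcongr
  · obtain ⟨T, hT⟩ := Filter.eventually_atTop.1 (hlower u₁ hu)
    refine ⟨max T₀ T, le_max_left _ _, fun t ht => ?_⟩
    have h2 := LogDampedWave.rate_nonneg n θ
      (by linarith [(le_max_left T₀ T).trans ht] : 0 ≤ t)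
    refine le_trans ?_ (hT t ((le_max_right _ _).trans ht))
    have h3 := min_le_right K⁻¹ c
    gcongr
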